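/- Let $\mathbb S^1=\mathbb R/\mathbb Z$ and let $f:\mathbb S^1\times\mathbb R\to\mathbb R$ be a $C^\infty$ function. Say that $f$ is *wild at* $+\infty$ (resp. $-\infty$) if $$\int_I\frac{ds}{\max(1,\sup_{t}f(t,s))}<\infty\quad\text{and}\quad\int_I\frac{ds}{\max(1,\sup_{t}(-f(t,s)))}<\infty$$ for $I=[0,+\infty)$ (resp. $I=(-\infty,0]$), and that $f$ is *tame* if it is neither wild at $+\infty$ nor wild at $-\infty$. Let $(B^1,B^0)$ be either $(C^1(\mathbb S^1;\mathbb R),C^0(\mathbb S^1;\mathbb R))$ or $(H^1(\mathbb S^1;\mathbb R),L^2(\mathbb S^1;\mathbb R))$, where $H^1$ is the Hilbert space of periodic absolutely continuous functions with derivative in $L^2$. Let $F:B^1\to B^0$, $F(u)(t)=u'(t)+f(t,u(t))$. For $u$ in $B^1$ or $B^0$ write $u=\tilde u+\bar u$ with $\bar u=\int_{\mathbb S^1}u$ (a constant) and $\int\tilde u=0$; let $\tilde B^i=\{u\in B^i:\bar u=0\}$. Call the sets $\{u\in B^i:\bar u=c\}$, $c\in\mathbb R$, horizontal hyperplanes and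 the sets $\tilde v+\mathbb R\cdot 1\subset B^0$, $\tilde v\in\tilde B^0$, vertical lines. **Theorem.** If $f$ is tame then, in both cases, writing $F(\tilde u+\bar u)=\tilde v+\bar v$, the map $\Psi:B^1\to B^0$, $\Psi(u)=\tilde v+\bar u$, is a global $C^\infty$ diffeomorphism. Consequently: 1. (Adapted coordinates.) There is a $C^\infty$ function $\phi:B^0\to\mathbb R$ with $F(\Psi^{-1}(\tilde v+\bar u))=\tilde v+\phi(\tilde v+\bar u)$ for all $\tilde v\in\tilde B^0$, $\bar u\in\mathbb R$; that is, $\mathbf F=F\circ\Psi^{-1}$ has the form $(\tilde v,\bar u)\mapsto(\tilde v,\phi(\tilde v,\bar u))$. 2. For each $c\in\mathbb R$ the map $\tilde B^1\to\tilde B^0$ taking $\tilde u$ to the average-zero part of $F(\tilde u+c)$ is a $C^\infty$ diffeomorphism. 3. (Sheets.) For each $c$, $F$ is injective on the horizontal hyperplane $\{\bar u=c\}$, its image is the graph $\{\tilde v+\psi(\tilde v):\tilde v\in\tilde B^0\}$ of a $C^\infty$ function $\psi:\tilde B^0\to\mathbb R$ (so it meets each vertical line exactly once), and for every $u$ in the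 hyperplane $B^0=DF(u)\tilde B^1\oplus\mathbb R\cdot 1$ (transversality). 4. (Fibres.) For each $\tilde v\in\tilde B^0$ the fibre $F^{-1}(\tilde v+\mathbb R\cdot 1)$ is the image of a $C^\infty$ curve $\gamma:\mathbb R\to B^1$, it meets each horizontal hyperplane $\{\bar u=c\}$ exactly in the point $\gamma(c)$, and $B^1=\mathbb R\gamma'(c)\oplus\tilde B^1$ for all $c$ (transversality). 5. (Foliation.) The fibres foliate $B^1$: the diffeomorphism $\Psi$ maps each fibre $F^{-1}(\tilde v+\mathbb R\cdot 1)$ onto the vertical line $\tilde v+\mathbb R\cdot 1$, and each horizontal hyperplane $\{\bar u=c\}$ of $B^1$ onto the horizontal hyperplane $\{\bar v=c\}$ of $B^0$. -/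

import Mathlib

open MeasureTheory Set
open scoped ContDiff Manifold

noncomputable section

/-! ### The nonlinearity

The circle `𝕊¹ = ℝ / ℤ` is `UnitAddCircle`; its measure `volume` has total mass `1`. -/

/-- `f : 𝕊¹ × ℝ → ℝ` is smooth: its lift to `ℝ × ℝ` (which is `1`-periodic in the first variable)
is of class `C^∞`. -/
def IsSmoothNonlinearity (f : UnitAddCircle → ℝ → ℝ) : Prop :=
  ContDiff ℝ ∞ (fun p : ℝ × ℝ => f (p.1 : UnitAddCircle) p.2)

/-- For an interval `I`, the two integrals
`∫_I ds / max(1, sup_t f(t,s))` and `∫_I ds / max(1, sup_t (-f(t,s)))` are both finite. -/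
def IsWildOn (f : UnitAddCircle → ℝ → ℝ) (I : Set ℝ) : Prop :=
  (∫⁻ s in I, ENNReal.ofReal (1 / max 1 (⨆ t, f t s))) < ⊤ ∧
  (∫⁻ s in I, ENNReal.ofReal (1 / max 1 (⨆ t, -f t s))) < ⊤

/-- `f` is tame if it is neither wild at `+∞` nor wild at `-∞`. -/
def IsTame (f : UnitAddCircle → ℝ → ℝ) : Prop :=
  ¬ IsWildOn f (Ici 0) ∧ ¬ IsWildOn f (Iic 0)

theorem IsSmoothNonlinearity.continuous {f : UnitAddCircle → ℝ → ℝ}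
    (hf : IsSmoothNonlinearity f) : Continuous (fun p : UnitAddCircle × ℝ => f p.1 p.2) := by
  have hq : IsOpenQuotientMap
      (Prod.map (fun x : ℝ => (x : UnitAddCircle)) (id : ℝ → ℝ)) :=
    IsOpenQuotientMap.prodMap QuotientAddGroup.isOpenQuotientMap_mk IsOpenQuotientMap.id
  exact hq.isQuotientMap.continuous_iff.2 (ContDiff.continuous hf)

/-- The continuous function `t ↦ f(t, u(t))`, for `u` continuous. -/
def nemytskii (f : UnitAddCircle → ℝ → ℝ) (hf : IsSmoothNonlinearity f)
    (u : C(UnitAddCircle, ℝ)) : C(UnitAddCircle, ℝ) where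
  toFun t := f t (u t)
  continuous_toFun := hf.continuous.comp (continuous_id.prodMk u.continuous)

/-! ### Splitting a space of functions into average-zero functions and constants -/

/-- An average functional on a space `B`, and the constant function `1` in `B`. -/
structure MeanSplitting (B : Type*) [AddCommGroup B] [Module ℝ B] where
  avg : B →ₗ[ℝ] ℝ
  one : B
  avg_one : avg one = 1

namespace MeanSplitting

variable {B : Type*} [AddCommGroup B] [Module ℝ B]

/-- The average-zero part `ũ = u - ∫ u`. -/
def tilde (S : MeanSplitting B) (u : B) : B := u - S.avg u • S.one

/-- The subspace of functions of average zero. -/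
def zeroMean (S : MeanSplitting B) : Submodule ℝ B := LinearMap.ker S.avg

/-- The subspace of constant functions. -/
def constants (S : MeanSplitting B) : Submodule ℝ B := Submodule.span ℝ {S.one}

/-- The horizontal hyperplane of functions of average `c`. -/
def horizontal (S : MeanSplitting B) (c : ℝ) : Set B := {u | S.avg u = c}

/-- The vertical line `{v + r | r ∈ ℝ}` through `v`. -/
def vertical (S : MeanSplitting B) (v : B) : Set B := {w | ∃ r : ℝ, w = v + r • S.one}

end MeanSplitting

/-! ### The `C` case -/

/-- `C⁰(𝕊¹; ℝ)` with the supremum norm. -/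
abbrev C0 : Type := C(UnitAddCircle, ℝ)

/-- `C¹(𝕊¹; ℝ)`, as the graph of the derivative: the pairs `(u, u')` of continuous functions on the
circle, the second being the derivative of the first, with norm `max (‖u‖_∞) (‖u'‖_∞)`. -/
def C1 : Submodule ℝ (C0 × C0) where
  carrier := {p | ∀ x : ℝ, HasDerivAt (fun y : ℝ => p.1 (y : UnitAddCircle))
    (p.2 (x : UnitAddCircle)) x}
  add_mem' {p q} hp hq x := by simpa using! (hp x).add (hq x)
  zero_mem' x := by simpa using! hasDerivAt_const x (0 : ℝ)
  smul_mem' c p hp x := by simpa using! (hp x).const_smul c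

/-- The average on `C⁰`. -/
def meanC0 : MeanSplitting C0 where
  avg :=
    { toFun := fun v => ∫ t, v t
      map_add' := fun v w =>
        integral_add (v.continuous.integrable_of_hasCompactSupport (HasCompactSupport.of_compactSpace _))
          (w.continuous.integrable_of_hasCompactSupport (HasCompactSupport.of_compactSpace _))
      map_smul' := fun c v => integral_const_mul c v }
  one := 1
  avg_one := by
    change ∫ _ : UnitAddCircle, (1 : ℝ) = 1
    simp [Measure.real]

/-- The average on `C¹`. -/
def meanC1 : MeanSplitting C1 where
  avg := meanC0.avg ∘ₗ LinearMap.fst ℝ C0 C0 ∘ₗ C1.subtype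
  one := ⟨(1, 0), fun x => by simpa using! hasDerivAt_const x (1 : ℝ)⟩
  avg_one := meanC0.avg_one

/-- The operator `F(u) = u' + f(t, u)` from `C¹` to `C⁰`. -/
def operatorC (f : UnitAddCircle → ℝ → ℝ) (hf : IsSmoothNonlinearity f) (u : C1) : C0 :=
  u.1.2 + nemytskii f hf u.1.1

/-! ### The `H` case -/

/-- `L²(𝕊¹; ℝ)`. -/
abbrev L2 : Type := Lp ℝ 2 (volume : Measure UnitAddCircle)

/-- `w` is (the continuous representative of) an absolutely continuous function on the circle which
is almost everywhere equal to `u`, and whose almost everywhere derivative is `g`. -/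
def IsACRep (w : C0) (u g : L2) : Prop :=
  (u : UnitAddCircle → ℝ) =ᵐ[volume] w ∧
  AbsolutelyContinuousOnInterval (fun x : ℝ => w (x : UnitAddCircle)) 0 1 ∧
  ∀ᵐ (x : ℝ) ∂(volume.restrict (Ioc (0 : ℝ) 1)),
    HasDerivAt (fun y : ℝ => w (y : UnitAddCircle)) (g (x : UnitAddCircle)) x

theorem ae_circle_lift {P : UnitAddCircle → Prop} (h : ∀ᵐ t, P t) :
    ∀ᵐ (x : ℝ) ∂(volume.restrict (Ioc (0 : ℝ) 1)), P (x : UnitAddCircle) := by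
  have := (UnitAddCircle.measurePreserving_mk 0).quasiMeasurePreserving.ae h
  simpa using! this

theorem IsACRep.add {w₁ w₂ : C0} {u₁ u₂ g₁ g₂ : L2} (h₁ : IsACRep w₁ u₁ g₁)
    (h₂ : IsACRep w₂ u₂ g₂) : IsACRep (w₁ + w₂) (u₁ + u₂) (g₁ + g₂) := by
  refine ⟨?_, by simpa using! h₁.2.1.add h₂.2.1, ?_⟩
  · filter_upwards [h₁.1, h₂.1, Lp.coeFn_add u₁ u₂] with t a b c
    rw [c, Pi.add_apply, a, b]
    rfl
  · filter_upwards [h₁.2.2, h₂.2.2, ae_circle_lift (Lp.coeFn_add g₁ g₂)] with t a b c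
    rw [c]
    simpa using! a.add b

theorem IsACRep.smul {w : C0} {u g : L2} (c : ℝ) (h : IsACRep w u g) :
    IsACRep (c • w) (c • u) (c • g) := by
  refine ⟨?_, by simpa using! h.2.1.const_smul c, ?_⟩
  · filter_upwards [h.1, Lp.coeFn_smul c u] with t a b
    rw [b, Pi.smul_apply, a]
    rfl
  · filter_upwards [h.2.2, ae_circle_lift (Lp.coeFn_smul c g)] with t a b
    rw [b]
    simpa using! a.const_smul c

theorem IsACRep.const (c : ℝ) :
    IsACRep (ContinuousMap.const _ c) (ContinuousMap.toLp 2 volume ℝ (ContinuousMap.const _ c))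
      0 := by
  refine ⟨ContinuousMap.coeFn_toLp _ _, ?_, ?_⟩
  · exact (contDiff_const (c := c)).contDiffOn.absolutelyContinuousOnInterval
  · filter_upwards [ae_circle_lift (Lp.coeFn_zero ℝ 2 (volume : Measure UnitAddCircle))] with x hx
    rw [hx]
    exact hasDerivAt_const x c

/-- `H¹(𝕊¹; ℝ)`, the periodic absolutely continuous functions with derivative in `L²`, as the graph
of the derivative: the pairs `(u, u')` in `L² × L²`, with the Hilbert norm
`(‖u‖² + ‖u'‖²)^(1/2)`. -/
def H1 : Submodule ℝ (WithLp 2 (L2 × L2)) where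
  carrier := {p | ∃ w : C0, IsACRep w p.fst p.snd}
  add_mem' := by
    rintro p q ⟨w, hw⟩ ⟨z, hz⟩
    exact ⟨w + z, hw.add hz⟩
  zero_mem' := by
    refine ⟨ContinuousMap.const _ 0, ?_⟩
    have h := IsACRep.const 0
    have e : ContinuousMap.const UnitAddCircle (0 : ℝ) = 0 := rfl
    rw [e, map_zero] at h
    exact h
  smul_mem' := by
    rintro c p ⟨w, hw⟩
    exact ⟨c • w, hw.smul c⟩

/-- The continuous representative of an element of `H¹` (it is unique). -/
def H1rep (u : H1) : C0 := Classical.choose u.2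

theorem H1rep_spec (u : H1) : IsACRep (H1rep u) u.1.fst u.1.snd := Classical.choose_spec u.2

/-- The average on `L²`. -/
def meanL2 : MeanSplitting L2 where
  avg :=
    { toFun := fun v => ∫ t, v t
      map_add' := fun v w => by
        rw [integral_congr_ae (Lp.coeFn_add v w)]
        exact integral_add ((Lp.memLp v).integrable one_le_two) ((Lp.memLp w).integrable one_le_two)
      map_smul' := fun c v => by
        rw [integral_congr_ae (Lp.coeFn_smul c v)]
        exact integral_const_mul c v }
  one := ContinuousMap.toLp 2 volume ℝ (ContinuousMap.const _ 1)
  avg_one := by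
    change ∫ t, (ContinuousMap.toLp 2 volume ℝ (ContinuousMap.const UnitAddCircle (1 : ℝ))) t = 1
    rw [integral_congr_ae (ContinuousMap.coeFn_toLp _ _)]
    simp [Measure.real]

/-- The average on `H¹`. -/
def meanH1 : MeanSplitting H1 where
  avg :=
    { toFun := fun u => meanL2.avg u.1.fst
      map_add' := fun u v => map_add meanL2.avg u.1.fst v.1.fst
      map_smul' := fun c u => map_smul meanL2.avg c u.1.fst }
  one := ⟨WithLp.toLp 2 (meanL2.one, 0), ⟨ContinuousMap.const _ 1, IsACRep.const 1⟩⟩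
  avg_one := meanL2.avg_one

/-- The operator `F(u) = u' + f(t, u)` from `H¹` to `L²`. -/
def operatorH (f : UnitAddCircle → ℝ → ℝ) (hf : IsSmoothNonlinearity f) (u : H1) : L2 :=
  u.1.snd + ContinuousMap.toLp 2 volume ℝ (nemytskii f hf (H1rep u))

/-! ### Global adapted coordinates -/

/-- The map `u ↦ ṽ + ū`, where `u = ũ + ū` and `F u = ṽ + v̄`. -/
def adaptedMap {B₁ B₀ : Type*} [AddCommGroup B₁] [Module ℝ B₁] [AddCommGroup B₀] [Module ℝ B₀]
    (S₁ : MeanSplitting B₁) (S₀ : MeanSplitting B₀) (F : B₁ → B₀) (u : B₁) : B₀ :=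
  S₀.tilde (F u) + S₁.avg u • S₀.one

/-- `Ψ = adaptedMap S₁ S₀ F` is a global smooth diffeomorphism, together with the geometric content
of this fact for `F`. -/
def HasGlobalAdaptedCoordinates {B₁ B₀ : Type*}
    [NormedAddCommGroup B₁] [NormedSpace ℝ B₁] [NormedAddCommGroup B₀] [NormedSpace ℝ B₀]
    (S₁ : MeanSplitting B₁) (S₀ : MeanSplitting B₀) (F : B₁ → B₀) : Prop :=
  ∃ Ψ : Diffeomorph 𝓘(ℝ, B₁) 𝓘(ℝ, B₀) B₁ B₀ ∞,
    (∀ u, Ψ u = adaptedMap S₁ S₀ F u) ∧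
    -- adapted coordinates: `F ∘ Ψ⁻¹` is `(ṽ, ū) ↦ (ṽ, φ(ṽ, ū))` with `φ` smooth
    (∃ φ : B₀ → ℝ, ContDiff ℝ ∞ φ ∧ ∀ v ∈ S₀.zeroMean, ∀ a : ℝ,
      F (Ψ.symm (v + a • S₀.one)) = v + φ (v + a • S₀.one) • S₀.one) ∧
    -- for each average `c`, the map `ũ ↦ ṽ` is a diffeomorphism
    (∀ c : ℝ, ∃ D : Diffeomorph 𝓘(ℝ, S₁.zeroMean) 𝓘(ℝ, S₀.zeroMean) S₁.zeroMean S₀.zeroMean ∞,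
      ∀ u : S₁.zeroMean, (D u : B₀) = S₀.tilde (F (u + c • S₁.one))) ∧
    -- sheets: `F` maps horizontal hyperplanes injectively onto smooth graphs over the average-zero
    -- functions, transversal to the vertical lines
    (∀ c : ℝ, InjOn F (S₁.horizontal c) ∧
      (∃ ψ : S₀.zeroMean → ℝ, ContDiff ℝ ∞ ψ ∧
        F '' S₁.horizontal c = {w | ∃ v : S₀.zeroMean, w = v + ψ v • S₀.one}) ∧
      ∀ u ∈ S₁.horizontal c,
        IsCompl (S₁.zeroMean.map (fderiv ℝ F u).toLinearMap) S₀.constants) ∧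
    -- fibres: the preimage of each vertical line is a smooth curve, meeting each horizontal
    -- hyperplane exactly once and transversally
    (∀ v ∈ S₀.zeroMean, ∃ γ : ℝ → B₁, ContDiff ℝ ∞ γ ∧
      range γ = F ⁻¹' S₀.vertical v ∧
      (∀ c : ℝ, F ⁻¹' S₀.vertical v ∩ S₁.horizontal c = {γ c}) ∧
      ∀ c : ℝ, IsCompl (Submodule.span ℝ {deriv γ c}) S₁.zeroMean) ∧
    -- foliation: `Ψ` straightens the fibres to the vertical lines, and preserves averages
    (∀ v ∈ S₀.zeroMean, Ψ '' (F ⁻¹' S₀.vertical v) = S₀.vertical v) ∧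
    (∀ c : ℝ, Ψ '' S₁.horizontal c = S₀.horizontal c)

end

/-! The map `J u = u' + ∫ u` is an isomorphism from `B¹` onto `B⁰`. In the variable `w = J u` the
adapted map becomes `w ↦ w + (average-zero part of f(t, u))`, where `u = prim w` depends compactly
on `w`. Both function spaces are treated at once through `PrimitiveOperator`; it remains to show
that this compact perturbation of the identity is a diffeomorphism.

Injectivity rests on one observation. The difference `k` of two solutions with the same image has
average zero and satisfies `k' = g - μ` with `|g| ≤ L |k|`. A periodic function attains the level
`0` both with `k' ≤ 0` and with `0 ≤ k'`; as `g` vanishes there, `μ = 0`, and Gronwall gives `k =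
0`. The same lemma shows that the linearization, the identity minus a compact operator, is
injective, hence invertible by the Fredholm alternative. So the map is injective with open image,
and its inverse is smooth.

Surjectivity follows once the image is closed, since `B⁰` is connected. Tameness enters only here:
if the image of `w` is bounded, then up to a continuous approximation `u' + f(t, u) = e` with `e`
bounded in `L¹` and `|u|` bounded at some point. Divergence of `∫ ds / max(1, sup (-f))` stops `u`
from escaping to `+∞` forwards in time, and divergence of the integral with `sup f` stops it
backwards; by periodicity a unit of time in either direction covers the circle. The end `-∞` is
symmetric. With `u` bounded, compactness of `prim` gives convergent subsequences.

The geometric statements are formal consequences of `Ψ` being a diffeomorphism that preserves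
averages and satisfies `tilde (Ψ u) = tilde (F u)`. -/

noncomputable section

/-! ### Continuous projections onto averages and average-zero parts -/

namespace MeanSplitting

variable {B : Type*} [NormedAddCommGroup B] [NormedSpace ℝ B] (S : MeanSplitting B)

/-- The average as a continuous functional. -/
def avgL (h : Continuous S.avg) : B →L[ℝ] ℝ := ⟨S.avg, h⟩

@[simp] theorem avgL_apply (h : Continuous S.avg) (u : B) : S.avgL h u = S.avg u := rfl

@[simp] theorem avg_tilde (u : B) : S.avg (S.tilde u) = 0 := by
  simp [tilde, S.avg_one]

theorem tilde_mem (u : B) : S.tilde u ∈ S.zeroMean := S.avg_tilde u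

theorem mem_zeroMean {u : B} : u ∈ S.zeroMean ↔ S.avg u = 0 := Iff.rfl

theorem tilde_add_avg (u : B) : S.tilde u + S.avg u • S.one = u := by simp [tilde]

theorem tilde_of_mem {v : B} (hv : v ∈ S.zeroMean) : S.tilde v = v := by
  simp [tilde, S.mem_zeroMean.1 hv]

theorem tilde_add_smul_one (v : B) (a : ℝ) : S.tilde (v + a • S.one) = S.tilde v := by
  simp only [tilde, map_add, map_smul, S.avg_one, smul_eq_mul, mul_one, add_smul]; abel

theorem tilde_smul_one (a : ℝ) : S.tilde (a • S.one) = 0 := by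
  simp [tilde, S.avg_one]

/-- The projection onto the average-zero part, as a continuous linear map. -/
def tildeL (h : Continuous S.avg) : B →L[ℝ] B :=
  ContinuousLinearMap.id ℝ B - (S.avgL h).smulRight S.one

@[simp] theorem tildeL_apply (h : Continuous S.avg) (u : B) : S.tildeL h u = S.tilde u := by
  simp [tildeL, tilde]

/-- The projection onto the average-zero part, with values in the average-zero subspace. -/
def projL (h : Continuous S.avg) : B →L[ℝ] S.zeroMean :=
  (S.tildeL h).codRestrict S.zeroMean fun u => by simpa using S.tilde_mem u

@[simp] theorem coe_projL (h : Continuous S.avg) (u : B) : (S.projL h u : B) = S.tilde u := by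
  simp [projL]

end MeanSplitting

/-! ### From a diffeomorphism to sheets, fibres and foliation -/

section Formal

variable {B₁ B₀ : Type*} [NormedAddCommGroup B₁] [NormedSpace ℝ B₁] [NormedAddCommGroup B₀]
  [NormedSpace ℝ B₀] {S₁ : MeanSplitting B₁} {S₀ : MeanSplitting B₀} {F : B₁ → B₀}

theorem avg_adaptedMap (u : B₁) : S₀.avg (adaptedMap S₁ S₀ F u) = S₁.avg u := by
  simp [adaptedMap, S₀.avg_one]

theorem tilde_adaptedMap (u : B₁) : S₀.tilde (adaptedMap S₁ S₀ F u) = S₀.tilde (F u) := by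
  rw [adaptedMap, S₀.tilde_add_smul_one, S₀.tilde_of_mem (S₀.tilde_mem _)]

/-- The derivative of the adapted map of a differentiable `F` is the adapted map of the
derivative of `F`. -/
theorem hasFDerivAt_adaptedMap (h₁ : Continuous S₁.avg) (h₀ : Continuous S₀.avg) {u : B₁}
    {F' : B₁ →L[ℝ] B₀} (hF : HasFDerivAt F F' u) :
    HasFDerivAt (adaptedMap S₁ S₀ F)
      (S₀.tildeL h₀ ∘L F' + (S₁.avgL h₁).smulRight S₀.one) u := by
  have h := ((S₀.tildeL h₀).hasFDerivAt.comp u hF).add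
    ((S₁.avgL h₁).smulRight S₀.one).hasFDerivAt
  refine h.congr_of_eventuallyEq (Filter.Eventually.of_forall fun w => ?_)
  simp [adaptedMap]

theorem mem_preimage_vertical {X : Type*} {F : X → B₀} {v : B₀} (hv : v ∈ S₀.zeroMean) (u : X) :
    u ∈ F ⁻¹' S₀.vertical v ↔ S₀.tilde (F u) = v := by
  constructor
  · rintro ⟨r, hr⟩
    rw [hr, S₀.tilde_add_smul_one, S₀.tilde_of_mem hv]
  · intro h
    exact ⟨S₀.avg (F u), by rw [← h, S₀.tilde_add_avg]⟩

/-- The geometric content of the adapted map being a diffeomorphism. -/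
theorem hasGlobalAdaptedCoordinates_of_diffeomorph (h₁ : Continuous S₁.avg)
    (h₀ : Continuous S₀.avg) (hF : ContDiff ℝ ∞ F)
    (Ψ : Diffeomorph 𝓘(ℝ, B₁) 𝓘(ℝ, B₀) B₁ B₀ ∞) (hΨ : ∀ u, Ψ u = adaptedMap S₁ S₀ F u) :
    HasGlobalAdaptedCoordinates S₁ S₀ F := by
  have hsymm : ContDiff ℝ ∞ Ψ.symm := Ψ.symm.contMDiff.contDiff
  have avgΨ (u : B₁) : S₀.avg (Ψ u) = S₁.avg u := by rw [hΨ, avg_adaptedMap]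
  have tildeΨ (u : B₁) : S₀.tilde (Ψ u) = S₀.tilde (F u) := by rw [hΨ, tilde_adaptedMap]
  have avgs (z : B₀) : S₁.avg (Ψ.symm z) = S₀.avg z := by
    rw [← avgΨ, Ψ.apply_symm_apply]
  have tildes (z : B₀) : S₀.tilde (F (Ψ.symm z)) = S₀.tilde z := by
    rw [← tildeΨ, Ψ.apply_symm_apply]
  have avgv {v : B₀} (hv : v ∈ S₀.zeroMean) (a : ℝ) : S₀.avg (v + a • S₀.one) = a := by
    simp [S₀.avg_one, S₀.mem_zeroMean.1 hv]
  have tildev {v : B₀} (hv : v ∈ S₀.zeroMean) (a : ℝ) : S₀.tilde (v + a • S₀.one) = v := by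
    rw [S₀.tilde_add_smul_one, S₀.tilde_of_mem hv]
  have ext₀ {w z : B₀} (ht : S₀.tilde w = S₀.tilde z) (ha : S₀.avg w = S₀.avg z) : w = z := by
    rw [← S₀.tilde_add_avg w, ht, ha, S₀.tilde_add_avg]
  have repr {v : B₀} (hv : v ∈ S₀.zeroMean) (a : ℝ) : F (Ψ.symm (v + a • S₀.one)) =
      v + S₀.avg (F (Ψ.symm (v + a • S₀.one))) • S₀.one := by
    conv_lhs => rw [← S₀.tilde_add_avg (F _), tildes, tildev hv]
  have hφ : ContDiff ℝ ∞ fun z => S₀.avg (F (Ψ.symm z)) :=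
    (S₀.avgL h₀).contDiff.comp (hF.comp hsymm)
  have mem_fibre {v : B₀} (hv : v ∈ S₀.zeroMean) (u : B₁) :
      u ∈ F ⁻¹' S₀.vertical v ↔ Ψ u = v + S₁.avg u • S₀.one := by
    rw [mem_preimage_vertical hv, ← tildeΨ]
    constructor
    · intro h
      rw [← h, ← avgΨ, S₀.tilde_add_avg]
    · intro h
      rw [h, tildev hv]
  refine ⟨Ψ, hΨ, ⟨_, hφ, fun v hv a => repr hv a⟩, ?_, ?_, ?_, ?_, ?_⟩
  · intro c
    have hD : ContDiff ℝ ∞ fun u : S₁.zeroMean => S₀.projL h₀ (F (u + c • S₁.one)) :=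
      (S₀.projL h₀).contDiff.comp
        (hF.comp ((S₁.zeroMean.subtypeL.contDiff).add contDiff_const))
    have hD' : ContDiff ℝ ∞ fun v : S₀.zeroMean => S₁.projL h₁ (Ψ.symm (v + c • S₀.one)) :=
      (S₁.projL h₁).contDiff.comp
        (hsymm.comp ((S₀.zeroMean.subtypeL.contDiff).add contDiff_const))
    refine ⟨⟨⟨_, _, fun u => ?_, fun v => ?_⟩, hD.contMDiff, hD'.contMDiff⟩, fun u => ?_⟩
    · apply Subtype.ext
      change S₁.tildeL h₁ (Ψ.symm (S₀.tildeL h₀ (F (u + c • S₁.one)) + c • S₀.one)) = u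
      rw [S₁.tildeL_apply, S₀.tildeL_apply]
      have : S₀.tilde (F (u + c • S₁.one)) + c • S₀.one = Ψ (u + c • S₁.one) := by
        rw [hΨ, adaptedMap]
        simp [S₁.avg_one, S₁.mem_zeroMean.1 u.2]
      rw [this, Ψ.symm_apply_apply, S₁.tilde_add_smul_one, S₁.tilde_of_mem u.2]
    · apply Subtype.ext
      change S₀.tildeL h₀ (F (S₁.tildeL h₁ (Ψ.symm (v + c • S₀.one)) + c • S₁.one)) = v
      rw [S₁.tildeL_apply, S₀.tildeL_apply]
      have : S₁.tilde (Ψ.symm (v + c • S₀.one)) + c • S₁.one = Ψ.symm (v + c • S₀.one) := by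
        conv_rhs => rw [← S₁.tilde_add_avg (Ψ.symm _), avgs, avgv v.2]
      rw [this, tildes, tildev v.2]
    · exact S₀.coe_projL h₀ _
  · intro c
    refine ⟨fun u hu w hw h => Ψ.injective (ext₀ ?_ ?_), ⟨fun v =>
      S₀.avg (F (Ψ.symm (v + c • S₀.one))), ?_, ?_⟩, fun u hu => ?_⟩
    · change S₀.tilde (Ψ u) = S₀.tilde (Ψ w)
      rw [tildeΨ, tildeΨ, h]
    · change S₀.avg (Ψ u) = S₀.avg (Ψ w)
      rw [avgΨ, avgΨ, show S₁.avg u = c from hu, show S₁.avg w = c from hw]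
    · exact hφ.comp ((S₀.zeroMean.subtypeL.contDiff).add contDiff_const)
    · ext w
      constructor
      · rintro ⟨u, hu, rfl⟩
        refine ⟨⟨_, S₀.tilde_mem (F u)⟩, ?_⟩
        have : S₀.tilde (F u) + c • S₀.one = Ψ u := by
          rw [hΨ, adaptedMap, show S₁.avg u = c from hu]
        simp only [this, Ψ.symm_apply_apply, S₀.tilde_add_avg]
      · rintro ⟨v, rfl⟩
        refine ⟨Ψ.symm (v + c • S₀.one), ?_, repr v.2 c⟩
        change S₁.avg _ = c
        rw [avgs, avgv v.2]
    · have hd : HasFDerivAt F (fderiv ℝ F u) u :=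
        (hF.differentiable (by simp) u).hasFDerivAt
      set F' := fderiv ℝ F u
      have hL := hasFDerivAt_adaptedMap h₁ h₀ hd
      rw [← show (Ψ : B₁ → B₀) = adaptedMap S₁ S₀ F from funext hΨ] at hL
      set L := S₀.tildeL h₀ ∘L F' + (S₁.avgL h₁).smulRight S₀.one
      have hLa (h : B₁) : L h = S₀.tilde (F' h) + S₁.avg h • S₀.one := by simp [L]
      have hM : HasFDerivAt Ψ.symm (fderiv ℝ Ψ.symm (Ψ u)) (Ψ u) :=
        (hsymm.differentiable (by simp) _).hasFDerivAt
      set M := fderiv ℝ Ψ.symm (Ψ u)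
      -- By the chain rule `M` and `L` are mutually inverse, where `L h` combines the average-zero
      -- part of `F' h` with the average of `h`. Transversality is read off from this.
      have hML : ∀ h, M (L h) = h := by
        have e : Ψ.symm ∘ Ψ = id := funext Ψ.symm_apply_apply
        have := (hM.comp u hL).unique (by rw [e]; exact hasFDerivAt_id u)
        exact fun h => DFunLike.congr_fun this h
      have hLM : ∀ h, L (M h) = h := by
        have e : Ψ ∘ Ψ.symm = id := funext Ψ.apply_symm_apply
        have hL' : HasFDerivAt Ψ L (Ψ.symm (Ψ u)) := by rwa [Ψ.symm_apply_apply]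
        have := (hL'.comp (Ψ u) hM).unique (by rw [e]; exact hasFDerivAt_id _)
        exact fun h => DFunLike.congr_fun this h
      constructor
      · rw [Submodule.disjoint_def]
        rintro _ ⟨h, hh, rfl⟩ hc
        obtain ⟨r, hr⟩ := Submodule.mem_span_singleton.1 hc
        have hr' : F' h = r • S₀.one := hr.symm
        have : L h = 0 := by
          rw [hLa, hr', S₀.tilde_smul_one, S₁.mem_zeroMean.1 hh]; simp
        have h0 : h = 0 := by rw [← hML h, this, map_zero]
        rw [h0, map_zero]
      · rw [codisjoint_iff, Submodule.eq_top_iff']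
        intro w
        -- The `L`-preimage of an average-zero vector has average zero, and `F'` sends it to that
        -- vector up to a constant; a constant then corrects the average.
        have h1 := hLM (S₀.tilde w)
        rw [hLa] at h1
        have ha : S₁.avg (M (S₀.tilde w)) = 0 := by
          simpa [S₀.avg_one] using congrArg S₀.avg h1
        have ht : S₀.tilde (F' (M (S₀.tilde w))) = S₀.tilde w := by simpa [ha] using h1
        refine Submodule.mem_sup.2 ⟨F' (M (S₀.tilde w)), ⟨_, ha, rfl⟩,
          (S₀.avg w - S₀.avg (F' (M (S₀.tilde w)))) • S₀.one,
          Submodule.mem_span_singleton.2 ⟨_, rfl⟩, ?_⟩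
        generalize F' (M (S₀.tilde w)) = y at ht
        calc y + (S₀.avg w - S₀.avg y) • S₀.one = S₀.tilde y + S₀.avg w • S₀.one := by
              rw [MeanSplitting.tilde, sub_smul]; abel
          _ = w := by rw [ht, S₀.tilde_add_avg]
  · intro v hv
    have hγ : ContDiff ℝ ∞ fun c : ℝ => Ψ.symm (v + c • S₀.one) :=
      hsymm.comp (contDiff_const.add (contDiff_id.smul contDiff_const))
    have avgγ (c : ℝ) : S₁.avg (Ψ.symm (v + c • S₀.one)) = c := by rw [avgs, avgv hv]
    have memγ (c : ℝ) : Ψ.symm (v + c • S₀.one) ∈ F ⁻¹' S₀.vertical v := by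
      rw [mem_fibre hv, Ψ.apply_symm_apply, avgγ]
    have eqγ {u : B₁} (hu : u ∈ F ⁻¹' S₀.vertical v) :
        u = Ψ.symm (v + S₁.avg u • S₀.one) := by
      rw [← (mem_fibre hv u).1 hu, Ψ.symm_apply_apply]
    refine ⟨fun c => Ψ.symm (v + c • S₀.one), hγ, ?_, fun c => ?_, fun c => ?_⟩
    · ext u
      constructor
      · rintro ⟨c, rfl⟩
        exact memγ c
      · intro hu
        exact ⟨S₁.avg u, (eqγ hu).symm⟩
    · ext u
      constructor
      · rintro ⟨hu, hc⟩
        rw [mem_singleton_iff]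
        conv_lhs => rw [eqγ hu, show S₁.avg u = c from hc]
      · rintro rfl
        exact ⟨memγ c, avgγ c⟩
    · have hd := (hγ.differentiable (by simp) c).hasDerivAt
      set γ' := deriv (fun c : ℝ => Ψ.symm (v + c • S₀.one)) c
      -- The curve is parametrized by its average, so its velocity has average `1` and is
      -- transversal to the average-zero functions.
      have ha : S₁.avg γ' = 1 := by
        have h1 : HasDerivAt (fun c : ℝ => S₁.avg (Ψ.symm (v + c • S₀.one))) (S₁.avg γ') c :=
          (S₁.avgL h₁).hasFDerivAt.comp_hasDerivAt c hd
        simp only [avgγ] at h1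
        exact h1.unique (hasDerivAt_id c)
      constructor
      · rw [Submodule.disjoint_def]
        intro x hx hx0
        obtain ⟨r, rfl⟩ := Submodule.mem_span_singleton.1 hx
        have : r = 0 := by simpa [ha] using S₁.mem_zeroMean.1 hx0
        simp [this]
      · rw [codisjoint_iff, Submodule.eq_top_iff']
        intro x
        refine Submodule.mem_sup.2 ⟨S₁.avg x • γ', Submodule.mem_span_singleton.2 ⟨_, rfl⟩,
          x - S₁.avg x • γ', ?_, by abel⟩
        rw [S₁.mem_zeroMean]
        simp [ha]
  · intro v hv
    ext w
    constructor
    · rintro ⟨u, hu, rfl⟩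
      exact ⟨_, (mem_fibre hv u).1 hu⟩
    · rintro ⟨r, rfl⟩
      refine ⟨Ψ.symm (v + r • S₀.one), ?_, Ψ.apply_symm_apply _⟩
      rw [mem_fibre hv, Ψ.apply_symm_apply, avgs, avgv hv]
  · intro c
    ext w
    constructor
    · rintro ⟨u, hu, rfl⟩
      exact (avgΨ u).trans hu
    · intro hw
      exact ⟨Ψ.symm w, (avgs w).trans hw, Ψ.apply_symm_apply w⟩

end Formal

/-! ### Smoothness of the superposition operator on `C⁰` -/

/-- The derivative `∂f/∂s` of a nonlinearity `f(t, s)`. -/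
def stateDeriv (f : UnitAddCircle → ℝ → ℝ) (t : UnitAddCircle) (s : ℝ) : ℝ := deriv (f t) s

theorem IsSmoothNonlinearity.hasDerivAt {f : UnitAddCircle → ℝ → ℝ} (hf : IsSmoothNonlinearity f)
    (t : UnitAddCircle) (s : ℝ) : HasDerivAt (f t) (stateDeriv f t s) s := by
  obtain ⟨x, rfl⟩ := QuotientAddGroup.mk_surjective t
  have h : ContDiff ℝ ∞ fun s : ℝ => f (x : UnitAddCircle) s :=
    ContDiff.comp (g := fun p : ℝ × ℝ => f (p.1 : UnitAddCircle) p.2) hf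
      (contDiff_prodMk_right x)
  exact (h.differentiable (by simp) s).hasDerivAt

theorem IsSmoothNonlinearity.stateDeriv {f : UnitAddCircle → ℝ → ℝ}
    (hf : IsSmoothNonlinearity f) : IsSmoothNonlinearity (stateDeriv f) := by
  have hf' : ContDiff ℝ ∞ (fun p : ℝ × ℝ => f (p.1 : UnitAddCircle) p.2) := hf
  have h : ContDiff ℝ ∞ fun p : ℝ × ℝ =>
      fderiv ℝ (fun p : ℝ × ℝ => f (p.1 : UnitAddCircle) p.2) p (0, 1) :=
    (hf'.fderiv_right (by simp)).clm_apply contDiff_const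
  rw [IsSmoothNonlinearity]
  convert! h using 2 with p
  have h1 := ((hf'.differentiable (by simp) p).hasFDerivAt).comp_hasDerivAt p.2
    ((hasDerivAt_const p.2 p.1).prodMk (hasDerivAt_id p.2))
  exact (hf.hasDerivAt _ _).unique h1

theorem continuous_nemytskii {f : UnitAddCircle → ℝ → ℝ} (hf : IsSmoothNonlinearity f) :
    Continuous (nemytskii f hf) := by
  refine ContinuousMap.continuous_of_continuous_uncurry _ ?_
  exact hf.continuous.comp (continuous_snd.prodMk continuous_eval)

/-- The mean value inequality is applied at each `t`; the estimate is uniform in `t` because `∂f/∂s`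
is uniformly close to its values on the graph of `u` in a thin strip around it. -/
theorem hasFDerivAt_nemytskii {f : UnitAddCircle → ℝ → ℝ} (hf : IsSmoothNonlinearity f) (u : C0) :
    HasFDerivAt (nemytskii f hf)
      (ContinuousLinearMap.mul ℝ C0 (nemytskii (stateDeriv f) hf.stateDeriv u)) u := by
  rw [hasFDerivAt_iff_isLittleO_nhds_zero, Asymptotics.isLittleO_iff]
  intro ε hε
  -- Shifting `u` by constants turns this uniformity into continuity at `0` of a curve in `C⁰`.
  let σ : ℝ → C0 := fun r => nemytskii (stateDeriv f) hf.stateDeriv (u + ContinuousMap.const _ r)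
  have hσ : Continuous σ := (continuous_nemytskii hf.stateDeriv).comp
    (continuous_const.add ContinuousMap.continuous_const')
  have hσ0 : σ 0 = nemytskii (stateDeriv f) hf.stateDeriv u := by
    simp only [σ]; congr 1; ext t; simp
  obtain ⟨δ, hδ, H⟩ := Metric.continuousAt_iff.1 hσ.continuousAt ε hε
  filter_upwards [Metric.ball_mem_nhds (0 : C0) hδ] with h hh
  rw [mem_ball_zero_iff] at hh
  rw [ContinuousMap.norm_le _ (by positivity)]
  intro t
  have hb : ∀ s ∈ segment ℝ (u t) (u t + h t),
      ‖stateDeriv f t s - stateDeriv f t (u t)‖ ≤ ε := by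
    intro s hs
    have hs' : |s - u t| ≤ |h t| := by
      rw [segment_eq_uIcc] at hs
      simpa using Set.abs_sub_left_of_mem_uIcc hs
    have h1 : dist (s - u t) 0 < δ := by
      rw [Real.dist_0_eq_abs]
      exact (hs'.trans (h.norm_coe_le_norm t)).trans_lt hh
    have h2 := (ContinuousMap.dist_apply_le_dist (f := σ (s - u t)) (g := σ 0) t).trans (H h1).le
    rw [hσ0, dist_eq_norm] at h2
    simpa [σ, nemytskii] using h2
  have key := (convex_segment (u t) (u t + h t)).norm_image_sub_le_of_norm_hasDerivWithin_le
    (f := fun s => f t s - stateDeriv f t (u t) * s)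
    (f' := fun s => stateDeriv f t s - stateDeriv f t (u t))
    (fun s _ => ((hf.hasDerivAt t s).sub
      (by simpa using (hasDerivAt_id s).const_mul (stateDeriv f t (u t)))).hasDerivWithinAt)
    hb (left_mem_segment ℝ _ _) (right_mem_segment ℝ _ _)
  have e : (nemytskii f hf (u + h) - nemytskii f hf u -
      ContinuousLinearMap.mul ℝ C0 (nemytskii (stateDeriv f) hf.stateDeriv u) h) t =
      f t (u t + h t) - stateDeriv f t (u t) * (u t + h t) -
        (f t (u t) - stateDeriv f t (u t) * u t) := by
    simp [nemytskii]; ring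
  rw [e]
  refine key.trans ?_
  simp only [add_sub_cancel_left]
  gcongr
  exact h.norm_coe_le_norm t

/-- The derivative is multiplication by the superposition operator of `∂f/∂s`, again a smooth
nonlinearity; hence the induction on the order with `f` generalized. -/
theorem contDiff_nemytskii {f : UnitAddCircle → ℝ → ℝ} (hf : IsSmoothNonlinearity f) :
    ContDiff ℝ ∞ (nemytskii f hf) := by
  refine contDiff_infty.2 fun n => ?_
  induction n generalizing f with
  | zero => exact contDiff_zero.2 (continuous_nemytskii hf)
  | succ n ih =>
    rw [Nat.cast_succ, contDiff_succ_iff_hasFDerivAt]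
    have hmul : ContDiff ℝ n fun v : C0 => ContinuousLinearMap.mul ℝ C0 v :=
      IsBoundedLinearMap.contDiff (ContinuousLinearMap.isBoundedLinearMap
        (ContinuousLinearMap.mul ℝ C0 : C0 →L[ℝ] C0 →L[ℝ] C0))
    exact ⟨fun u => ContinuousLinearMap.mul ℝ C0 (nemytskii (stateDeriv f) hf.stateDeriv u),
      hmul.comp (ih hf.stateDeriv), hasFDerivAt_nemytskii hf⟩

instance : IsProbabilityMeasure (volume : Measure UnitAddCircle) :=
  ⟨UnitAddCircle.measure_univ⟩

/-! ### Level crossings of periodic functions and uniqueness -/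

section Periodic

theorem UnitAddCircle.periodic_coe {α : Type*} (u : UnitAddCircle → α) :
    Function.Periodic (fun x : ℝ => u (x : UnitAddCircle)) 1 := fun x => by
  simp only [AddCircle.coe_add_period]

/-- A differentiable periodic function takes each of its values at some point where it is
nonincreasing. -/
theorem Function.Periodic.exists_eq_deriv_nonpos {y y' : ℝ → ℝ} (hp : Function.Periodic y 1)
    (hy : ∀ x, HasDerivAt y (y' x) x) (x₀ : ℝ) : ∃ x, y x = y x₀ ∧ y' x ≤ 0 := by
  by_contra! H
  -- If every crossing of the level were strictly increasing, `y` could not drop below the level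
  -- after reaching it. Starting from `x₀` and from `x₀ - 1` makes `x₀` a local minimum, where the
  -- derivative vanishes.
  have hle (b : ℝ) (hb : y b = y x₀) : ∀ x ∈ Icc b (b + 1), y x₀ ≤ y x := fun x hx =>
    image_le_of_deriv_right_lt_deriv_boundary (f := fun _ => y x₀) (f' := fun _ => 0)
      continuousOn_const (fun x _ => hasDerivWithinAt_const x _ _) hb.ge hy
      (fun z _ hz => H z hz.symm) hx
  have hmin : IsLocalMin y x₀ := by
    filter_upwards [Icc_mem_nhds (sub_one_lt x₀) (lt_add_one x₀)] with x hx
    rcases le_total x₀ x with h | h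
    · exact hle x₀ rfl x ⟨h, hx.2⟩
    · exact hle (x₀ - 1) (hp.sub_eq x₀) x ⟨hx.1, by linarith⟩
  exact (H x₀ rfl).ne' (hmin.hasDerivAt_eq_zero (hy x₀))

theorem Function.Periodic.exists_eq_deriv_nonneg {y y' : ℝ → ℝ} (hp : Function.Periodic y 1)
    (hy : ∀ x, HasDerivAt y (y' x) x) (x₀ : ℝ) : ∃ x, y x = y x₀ ∧ 0 ≤ y' x := by
  obtain ⟨x, h, h'⟩ := Function.Periodic.exists_eq_deriv_nonpos (y := fun x => -y x)
    (y' := fun x => -y' x) (fun x => by simp [hp x]) (fun x => (hy x).neg) x₀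
  exact ⟨x, by simpa using h, by simpa using h'⟩

theorem C0.integrable (u : C0) : Integrable u :=
  u.continuous.integrable_of_hasCompactSupport (HasCompactSupport.of_compactSpace _)

/-- A continuous function on the circle takes its average value. -/
theorem C0.exists_eq_integral (u : C0) : ∃ x : ℝ, u (x : UnitAddCircle) = ∫ t, u t := by
  obtain ⟨t, ht⟩ := mem_range_of_exists_le_of_exists_ge u.continuous
    (exists_le_integral u.integrable) (exists_integral_le u.integrable)
  obtain ⟨x, rfl⟩ := QuotientAddGroup.mk_surjective t
  exact ⟨x, ht⟩

/-- Uniqueness: a function of average zero with `k' = g - μ`, where `|g| ≤ L |k|`, vanishes. -/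
theorem C0.eq_zero_of_hasDerivAt {k g : C0} {μ L : ℝ}
    (hk : ∀ x : ℝ, HasDerivAt (fun y : ℝ => k (y : UnitAddCircle)) (g (x : UnitAddCircle) - μ) x)
    (hg : ∀ t, |g t| ≤ L * |k t|) (h0 : ∫ t, k t = 0) : k = 0 := by
  obtain ⟨x₀, hx₀⟩ := k.exists_eq_integral
  rw [h0] at hx₀
  have hp := UnitAddCircle.periodic_coe k
  have hg0 (t) (h : k t = 0) : g t = 0 := by simpa [h] using hg t
  obtain ⟨x, hx, hx'⟩ := hp.exists_eq_deriv_nonpos hk x₀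
  obtain ⟨z, hz, hz'⟩ := hp.exists_eq_deriv_nonneg hk x₀
  simp only [hx₀] at hx hz
  rw [hg0 _ hx] at hx'
  rw [hg0 _ hz] at hz'
  -- At the two zeros the derivative of `k` is `-μ`, once nonpositive and once nonnegative.
  have hμ : μ = 0 := by linarith
  subst hμ
  ext t
  obtain ⟨s, rfl⟩ := QuotientAddGroup.mk_surjective t
  obtain ⟨r, hr, hrs⟩ := hp.exists_mem_Ico one_pos s x₀
  change k (s : UnitAddCircle) = 0
  rw [hrs]
  exact eq_zero_of_abs_deriv_le_mul_abs_self_of_eq_zero_right (a := x₀) (b := x₀ + 1) (K := L)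
    (f := fun y : ℝ => k (y : UnitAddCircle)) (fun x _ => (hk x).continuousAt.continuousWithinAt)
    (fun x _ => (hk x).hasDerivWithinAt) hx₀ (fun x _ => by simpa using hg x) r ⟨hr.1, hr.2.le⟩

end Periodic

/-! ### A priori bounds from divergence of the wildness integrals -/

section Barrier

/-- If `∫ ds / G(s)` diverges at `+∞`, then solutions of `x' ≤ G(x) + |e|` stay bounded
for a unit time. -/
theorem exists_bound_of_lintegral_eq_top {G : ℝ → ℝ} (hG : Continuous G) (hG1 : ∀ s, 1 ≤ G s)
    (hdiv : ∫⁻ s in Ici (0 : ℝ), ENNReal.ofReal (1 / G s) = ⊤) (M : ℝ) :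
    ∃ R, ∀ (x x' e : ℝ → ℝ) (t₀ : ℝ), Continuous e → (∀ t, HasDerivAt x (x' t) t) →
      (∀ t, x' t ≤ G (x t) + |e t|) → x t₀ ≤ M → ∫ t in t₀..t₀ + 1, |e t| ≤ M →
      ∀ t ∈ Icc t₀ (t₀ + 1), x t ≤ R := by
  have hpos (s) : 0 < G s := one_pos.trans_le (hG1 s)
  have hc : Continuous fun s => 1 / G s := continuous_const.div hG fun s => (hpos s).ne'
  set Φ : ℝ → ℝ := fun s => ∫ r in (0 : ℝ)..s, 1 / G r with hΦ
  have hΦ' (s) : HasDerivAt Φ (1 / G s) s :=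
    intervalIntegral.integral_hasDerivAt_right (hc.intervalIntegrable _ _)
      (hc.stronglyMeasurableAtFilter _ _) hc.continuousAt
  have hmono : Monotone Φ := monotone_of_deriv_nonneg (fun s => (hΦ' s).differentiableAt)
    fun s => by rw [(hΦ' s).deriv]; exact (one_div_pos.2 (hpos s)).le
  have hunb (C : ℝ) : ∃ R, C < Φ R := by
    by_contra! H
    have hint : IntegrableOn (fun s => 1 / G s) (Ioi 0) := by
      refine integrableOn_Ioi_of_intervalIntegral_norm_bounded C 0 (b := fun n : ℕ => (n : ℝ))
        (fun n => hc.integrableOn_Ioc) tendsto_natCast_atTop_atTop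
        (Filter.Eventually.of_forall fun n => ?_)
      simpa only [Real.norm_eq_abs, abs_of_pos (one_div_pos.2 (hpos _))] using H n
    have := hint.lintegral_lt_top
    rw [← setLIntegral_congr Ioi_ae_eq_Ici] at hdiv
    exact this.ne hdiv
  -- Along a solution `(Φ ∘ x)' ≤ (G + |e|) / G ≤ 1 + |e|` because `1 ≤ G`. So `Φ ∘ x` grows over
  -- unit time by at most `1 + M` from a value at most `Φ M`.
  obtain ⟨R, hR⟩ := hunb (Φ M + 1 + M)
  refine ⟨R, fun x x' e t₀ he hx hle h0 heM t ht => ?_⟩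
  by_contra! hlt
  have hE : Monotone fun t => t + (∫ r in t₀..t, |e r|) - Φ (x t) := by
    have hd (t : ℝ) : HasDerivAt (fun t => t + (∫ r in t₀..t, |e r|) - Φ (x t))
        (1 + |e t| - 1 / G (x t) * x' t) t :=
      ((hasDerivAt_id t).add (intervalIntegral.integral_hasDerivAt_right
        (he.abs.intervalIntegrable _ _) (he.abs.stronglyMeasurableAtFilter _ _)
        he.abs.continuousAt)).sub ((hΦ' (x t)).comp t (hx t))
    refine monotone_of_deriv_nonneg (fun t => (hd t).differentiableAt) fun t => ?_
    rw [(hd t).deriv, sub_nonneg, one_div_mul_eq_div, div_le_iff₀ (hpos _)]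
    nlinarith [hle t, hG1 (x t), abs_nonneg (e t)]
  have h1 := hE ht.1
  have h2 : ∫ r in t₀..t, |e r| ≤ ∫ r in t₀..t₀ + 1, |e r| :=
    intervalIntegral.integral_mono_interval le_rfl ht.1 ht.2
      (Filter.Eventually.of_forall fun r => abs_nonneg _) (he.abs.intervalIntegrable _ _)
  simp only [intervalIntegral.integral_same, add_zero] at h1
  linarith [hmono hlt.le, hmono h0, ht.2]

/-- The barrier for an equation on the circle. -/
theorem exists_bound_of_lintegral_sup_eq_top {h : UnitAddCircle → ℝ → ℝ}
    (hh : Continuous fun p : UnitAddCircle × ℝ => h p.1 p.2)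
    (hdiv : ∫⁻ s in Ici (0 : ℝ), ENNReal.ofReal (1 / max 1 (⨆ t, h t s)) = ⊤) (M : ℝ) :
    ∃ R, ∀ (x x' : ℝ → ℝ) (θ : ℝ → UnitAddCircle) (e : C0), Function.Periodic x 1 →
      (∀ t, HasDerivAt x (x' t) t) → (∀ t, x' t ≤ h (θ t) (x t) + |e (t : UnitAddCircle)|) →
      (∃ t, x t ≤ M) → ∫ t, |e t| ≤ M → ∀ t, x t ≤ R := by
  have hsup : Continuous fun s => ⨆ t, h t s := by
    have := isCompact_univ.continuous_sSup (f := fun (s : ℝ) (t : UnitAddCircle) => h t s)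
      (hh.comp continuous_swap)
    simpa only [image_univ] using! this
  obtain ⟨R, hR⟩ := exists_bound_of_lintegral_eq_top (continuous_const.max hsup)
    (fun s => le_max_left 1 _) hdiv M
  refine ⟨R, fun x x' θ e hp hx hle ⟨t₀, h0⟩ heM t => ?_⟩
  obtain ⟨r, hr, hrt⟩ := hp.exists_mem_Ico one_pos t t₀
  rw [hrt]
  refine hR x x' (fun t => e (t : UnitAddCircle)) t₀
    (e.continuous.comp (AddCircle.continuous_mk' 1)) hx (fun t => (hle t).trans ?_) h0 ?_ r
    ⟨hr.1, hr.2.le⟩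
  · gcongr
    refine le_trans ?_ (le_max_right _ _)
    exact le_ciSup (f := fun t => h t _) (isCompact_range
      (hh.comp (continuous_id.prodMk continuous_const))).bddAbove (θ t)
  · rwa [UnitAddCircle.intervalIntegral_preimage t₀ (fun t => |e t|)]

/-- This carries the condition at `-∞` over to `+∞` under `u ↦ -u`. -/
theorem lintegral_Iic_comp_neg (φ : ℝ → ENNReal) :
    ∫⁻ s in Ici (0 : ℝ), φ (-s) = ∫⁻ s in Iic (0 : ℝ), φ s := by
  have h := (Measure.measurePreserving_neg (volume : Measure ℝ)).setLIntegral_comp_preimage_emb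
    (MeasurableEquiv.neg ℝ).measurableEmbedding φ (Iic 0)
  simpa using! h

/-- The a priori bound for tame nonlinearities. -/
theorem IsTame.exists_norm_le {f : UnitAddCircle → ℝ → ℝ} (hf : IsSmoothNonlinearity f)
    (ht : IsTame f) (M : ℝ) : ∃ R, ∀ u e : C0,
      (∀ x : ℝ, HasDerivAt (fun y : ℝ => u (y : UnitAddCircle))
        (e (x : UnitAddCircle) - f (x : UnitAddCircle) (u (x : UnitAddCircle))) x) →
      (∃ t, |u t| ≤ M) → ∫ t, |e t| ≤ M → ‖u‖ ≤ R := by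
  have hneg : Continuous fun p : UnitAddCircle × ℝ => f p.1 (-p.2) :=
    hf.continuous.comp (continuous_fst.prodMk continuous_snd.neg)
  have reflect (e : C0) : ∃ e' : C0, (∀ x : ℝ, e' (x : UnitAddCircle) =
      e ((-x : ℝ) : UnitAddCircle)) ∧ ∫ t, |e' t| = ∫ t, |e t| := by
    refine ⟨⟨fun t => e (-t), by fun_prop⟩, fun x => rfl, ?_⟩
    exact integral_neg_eq_self (fun t => |e t|) volume
  have hrev {u : C0} {e : C0} (h : ∀ x : ℝ, HasDerivAt (fun y : ℝ => u (y : UnitAddCircle))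
      (e (x : UnitAddCircle) - f (x : UnitAddCircle) (u (x : UnitAddCircle))) x) (x : ℝ) :
      HasDerivAt (fun y : ℝ => u ((-y : ℝ) : UnitAddCircle))
        (-(e ((-x : ℝ) : UnitAddCircle) -
          f ((-x : ℝ) : UnitAddCircle) (u ((-x : ℝ) : UnitAddCircle)))) x := by
    simpa using! (h (-x)).comp x (hasDerivAt_neg x)
  have hrevp (u : C0) : Function.Periodic (fun y : ℝ => u ((-y : ℝ) : UnitAddCircle)) 1 :=
    fun x => by
      simp only [neg_add_rev]
      rw [add_comm, ← sub_eq_add_neg, (UnitAddCircle.periodic_coe u).sub_eq]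
  have upper : ∃ R, ∀ u e : C0, (∀ x : ℝ, HasDerivAt (fun y : ℝ => u (y : UnitAddCircle))
        (e (x : UnitAddCircle) - f (x : UnitAddCircle) (u (x : UnitAddCircle))) x) →
      (∃ t, |u t| ≤ M) → ∫ t, |e t| ≤ M → ∀ t, u t ≤ R := by
    -- If the integral with `sup f` diverges, time is reversed: `y(x) = u(-x)` satisfies `y' = f -
    -- e`. If the one with `sup (-f)` diverges, `u' = e - f` is used directly.
    rcases not_and_or.1 ht.1 with h | h
    · obtain ⟨R, hR⟩ := exists_bound_of_lintegral_sup_eq_top hf.continuous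
        (not_lt_top_iff.1 h) M
      refine ⟨R, fun u e hu ⟨t₀, h0⟩ he t => ?_⟩
      obtain ⟨e', he', hint⟩ := reflect e
      obtain ⟨x₀, rfl⟩ := QuotientAddGroup.mk_surjective t₀
      obtain ⟨x, rfl⟩ := QuotientAddGroup.mk_surjective t
      have := hR _ _ (fun x : ℝ => ((-x : ℝ) : UnitAddCircle)) e' (hrevp u) (hrev hu)
        (fun x => ?_) ⟨-x₀, ?_⟩ (hint.trans_le he) (-x)
      · simpa using! this
      · rw [he']
        linarith [neg_abs_le (e ((-x : ℝ) : UnitAddCircle))]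
      · simpa using! (abs_le.1 h0).2
    · obtain ⟨R, hR⟩ := exists_bound_of_lintegral_sup_eq_top hf.continuous.neg
        (not_lt_top_iff.1 h) M
      refine ⟨R, fun u e hu ⟨t₀, h0⟩ he t => ?_⟩
      obtain ⟨x₀, rfl⟩ := QuotientAddGroup.mk_surjective t₀
      obtain ⟨x, rfl⟩ := QuotientAddGroup.mk_surjective t
      refine hR _ _ (fun x : ℝ => (x : UnitAddCircle)) e (UnitAddCircle.periodic_coe u) hu
        (fun x => ?_) ⟨x₀, (abs_le.1 h0).2⟩ he x
      linarith [le_abs_self (e (x : UnitAddCircle))]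
  have lower : ∃ R, ∀ u e : C0, (∀ x : ℝ, HasDerivAt (fun y : ℝ => u (y : UnitAddCircle))
        (e (x : UnitAddCircle) - f (x : UnitAddCircle) (u (x : UnitAddCircle))) x) →
      (∃ t, |u t| ≤ M) → ∫ t, |e t| ≤ M → ∀ t, -u t ≤ R := by
    -- Now `-u` has derivative `f - e`, so the two cases exchange roles: divergence with `sup f`
    -- works forwards, divergence with `sup (-f)` after time reversal.
    rcases not_and_or.1 ht.2 with h | h
    · rw [not_lt_top_iff, ← lintegral_Iic_comp_neg] at h
      obtain ⟨R, hR⟩ := exists_bound_of_lintegral_sup_eq_top hneg h M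
      refine ⟨R, fun u e hu ⟨t₀, h0⟩ he t => ?_⟩
      obtain ⟨x₀, rfl⟩ := QuotientAddGroup.mk_surjective t₀
      obtain ⟨x, rfl⟩ := QuotientAddGroup.mk_surjective t
      refine hR (fun x : ℝ => -u (x : UnitAddCircle)) _ (fun x : ℝ => (x : UnitAddCircle)) e
        (UnitAddCircle.periodic_coe fun t => -u t) (fun x => (hu x).neg)
        (fun x => ?_) ⟨x₀, neg_le.1 (abs_le.1 h0).1⟩ he x
      rw [neg_neg]
      linarith [neg_abs_le (e (x : UnitAddCircle))]
    · rw [not_lt_top_iff, ← lintegral_Iic_comp_neg] at h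
      obtain ⟨R, hR⟩ := exists_bound_of_lintegral_sup_eq_top hneg.neg h M
      refine ⟨R, fun u e hu ⟨t₀, h0⟩ he t => ?_⟩
      obtain ⟨e', he', hint⟩ := reflect e
      obtain ⟨x₀, rfl⟩ := QuotientAddGroup.mk_surjective t₀
      obtain ⟨x, rfl⟩ := QuotientAddGroup.mk_surjective t
      have := hR (fun x : ℝ => -u ((-x : ℝ) : UnitAddCircle)) _
        (fun x : ℝ => ((-x : ℝ) : UnitAddCircle)) e'
        (fun x => congrArg Neg.neg (hrevp u x)) (fun x => (hrev hu x).neg)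
        (fun x => ?_) ⟨-x₀, ?_⟩ (hint.trans_le he) (-x)
      · simpa using! this
      · rw [he', neg_neg, neg_neg]
        linarith [le_abs_self (e ((-x : ℝ) : UnitAddCircle))]
      · simpa using! neg_le.1 (abs_le.1 h0).1
  obtain ⟨R₁, h₁⟩ := upper
  obtain ⟨R₂, h₂⟩ := lower
  refine ⟨max R₁ R₂, fun u e hu h0 he => ?_⟩
  have hR : ∀ t, ‖u t‖ ≤ max R₁ R₂ := fun t =>
    abs_le'.2 ⟨(h₁ u e hu h0 he t).trans (le_max_left _ _),
      (h₂ u e hu h0 he t).trans (le_max_right _ _)⟩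
  exact (ContinuousMap.norm_le u ((norm_nonneg _).trans (hR 0))).2 hR

end Barrier

/-! ### The adapted map as a compact perturbation of the identity -/

/-- A Banach space of functions on the circle, containing the continuous functions, together with
the operator `prim` which maps `w` to the function `u` such that `u' = w - ∫ w` and `∫ u = ∫ w`. -/
structure PrimitiveOperator {B : Type*} [NormedAddCommGroup B] [NormedSpace ℝ B]
    (S : MeanSplitting B) where
  continuous_avg : Continuous S.avg
  incl : C0 →L[ℝ] B
  denseRange_incl : DenseRange incl
  incl_one : incl 1 = S.one
  avg_incl : ∀ g, S.avg (incl g) = ∫ t, g t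
  integral_abs_le : ∀ g, ∫ t, |g t| ≤ ‖incl g‖
  prim : B →L[ℝ] C0
  isCompactOperator_prim : IsCompactOperator prim
  integral_prim : ∀ w, ∫ t, prim w t = S.avg w
  hasDerivAt_prim_incl : ∀ (g : C0) (x : ℝ),
    HasDerivAt (fun y : ℝ => prim (incl g) (y : UnitAddCircle)) (g (x : UnitAddCircle) - ∫ t, g t) x

theorem exists_abs_le_of_continuous {f : UnitAddCircle → ℝ → ℝ}
    (hf : Continuous fun p : UnitAddCircle × ℝ => f p.1 p.2) (R : ℝ) :
    ∃ C, 0 ≤ C ∧ ∀ t s, |s| ≤ R → |f t s| ≤ C := by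
  obtain ⟨C, hC⟩ := (isCompact_univ.prod (isCompact_Icc (a := -R) (b := R))).exists_bound_of_continuousOn
    hf.continuousOn
  exact ⟨max C 0, le_max_right _ _, fun t s hs =>
    (hC (t, s) ⟨mem_univ _, abs_le.1 hs⟩).trans (le_max_left _ _)⟩

theorem IsSmoothNonlinearity.exists_abs_sub_le {f : UnitAddCircle → ℝ → ℝ}
    (hf : IsSmoothNonlinearity f) (R : ℝ) :
    ∃ L, ∀ t s₁ s₂, |s₁| ≤ R → |s₂| ≤ R → |f t s₁ - f t s₂| ≤ L * |s₁ - s₂| := by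
  obtain ⟨L, -, hL⟩ := exists_abs_le_of_continuous hf.stateDeriv.continuous R
  exact ⟨L, fun t s₁ s₂ h₁ h₂ =>
    (convex_Icc (-R) R).norm_image_sub_le_of_norm_hasDerivWithin_le
      (fun s _ => (hf.hasDerivAt t s).hasDerivWithinAt) (fun s hs => hL t s (abs_le.2 hs))
      (abs_le.1 h₂) (abs_le.1 h₁)⟩

namespace PrimitiveOperator

variable {B : Type*} [NormedAddCommGroup B] [NormedSpace ℝ B] {S : MeanSplitting B}
  (P : PrimitiveOperator S)

/-- The average-zero part of a continuous function, in `B`. -/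
def inclTilde : C0 →L[ℝ] B := S.tildeL P.continuous_avg ∘L P.incl

theorem inclTilde_apply (g : C0) : P.inclTilde g = S.tilde (P.incl g) := by simp [inclTilde]

theorem avg_inclTilde (g : C0) : S.avg (P.inclTilde g) = 0 := by
  rw [inclTilde_apply, S.avg_tilde]

theorem hasDerivAt_prim_inclTilde (g : C0) (x : ℝ) :
    HasDerivAt (fun y : ℝ => P.prim (P.inclTilde g) (y : UnitAddCircle))
      (g (x : UnitAddCircle) - ∫ t, g t) x := by
  have h := (P.hasDerivAt_prim_incl g x).sub
    ((P.hasDerivAt_prim_incl 1 x).const_mul (∫ t, g t))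
  have e : P.inclTilde g = P.incl g - (∫ t, g t) • P.incl 1 := by
    rw [inclTilde_apply, MeanSplitting.tilde, P.avg_incl, P.incl_one]
  rw [e]
  simpa using! h

variable {f : UnitAddCircle → ℝ → ℝ} (hf : IsSmoothNonlinearity f)

/-- The adapted map, in terms of `w = u' + ∫ u`. -/
def adapted (w : B) : B := w + P.inclTilde (nemytskii f hf (P.prim w))

theorem contDiff_adapted : ContDiff ℝ ∞ (P.adapted hf) :=
  contDiff_id.add (P.inclTilde.contDiff.comp ((contDiff_nemytskii hf).comp P.prim.contDiff))

/-- The uniqueness lemma for `k = prim w`, which has average zero and derivative `∫ g - g`. It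
serves both the injectivity of the nonlinear map and that of its linearization. -/
theorem eq_zero_of_eq_neg_inclTilde {w : B} {g : C0} {L : ℝ} (hw : w = -P.inclTilde g)
    (hg : ∀ t, |g t| ≤ L * |P.prim w t|) : w = 0 := by
  have hk : P.prim w = 0 := by
    refine C0.eq_zero_of_hasDerivAt (g := -g) (μ := -∫ t, g t) (L := L) (fun x => ?_)
      (fun t => by simpa using hg t) ?_
    · have h := (P.hasDerivAt_prim_inclTilde g x).neg
      have e : -(g (x : UnitAddCircle) - ∫ t, g t) = (-g) (x : UnitAddCircle) - -∫ t, g t := by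
        rw [ContinuousMap.neg_apply]; ring
      rw [e] at h
      rw [hw, map_neg]
      exact h
    · rw [P.integral_prim, hw, map_neg, avg_inclTilde, neg_zero]
  have hg0 : g = 0 := by
    ext t
    simpa [hk] using hg t
  rw [hw, hg0, map_zero, neg_zero]

theorem adapted_injective : Function.Injective (P.adapted hf) := by
  intro w₁ w₂ h
  obtain ⟨L, hL⟩ := hf.exists_abs_sub_le (max ‖P.prim w₁‖ ‖P.prim w₂‖)
  refine sub_eq_zero.1 (P.eq_zero_of_eq_neg_inclTilde (L := L)
    (g := nemytskii f hf (P.prim w₁) - nemytskii f hf (P.prim w₂)) ?_ fun t => ?_)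
  · simp only [adapted] at h
    rw [map_sub, neg_sub, sub_eq_sub_iff_add_eq_add, h, add_comm]
  · rw [map_sub]
    exact hL t _ _ (((P.prim w₁).norm_coe_le_norm t).trans (le_max_left _ _))
      (((P.prim w₂).norm_coe_le_norm t).trans (le_max_right _ _))

/-- The compact part of the derivative of the adapted map, up to sign. -/
def perturbation (a : C0) : B →L[ℝ] B :=
  -(P.inclTilde ∘L (ContinuousLinearMap.mul ℝ C0 a : C0 →L[ℝ] C0) ∘L P.prim)

theorem perturbation_apply (a : C0) (w : B) :
    P.perturbation a w = -P.inclTilde (a * P.prim w) := rfl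

/-- Fredholm alternative: either `1` is an eigenvalue of the compact perturbation, which uniqueness
excludes, or it lies in the resolvent set. -/
theorem isUnit_one_sub_perturbation [CompleteSpace B] (a : C0) :
    IsUnit (1 - P.perturbation a) := by
  have hc : IsCompactOperator (P.perturbation a) :=
    ((P.isCompactOperator_prim.clm_comp (ContinuousLinearMap.mul ℝ C0 a : C0 →L[ℝ] C0)).clm_comp
      P.inclTilde).neg
  rcases hc.hasEigenvalue_or_mem_resolventSet (one_ne_zero (α := ℝ)) with h | h
  · obtain ⟨w, hw⟩ := h.exists_hasEigenvector
    have e : P.perturbation a w = w := by simpa using hw.apply_eq_smul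
    refine (hw.2 (P.eq_zero_of_eq_neg_inclTilde (L := ‖a‖) (e.symm.trans
      (P.perturbation_apply a w)) fun t => ?_)).elim
    rw [ContinuousMap.mul_apply, abs_mul]
    gcongr
    exact a.norm_coe_le_norm t
  · simpa [resolventSet] using h

theorem hasFDerivAt_adapted (w : B) : HasFDerivAt (P.adapted hf)
    (1 - P.perturbation (nemytskii (stateDeriv f) hf.stateDeriv (P.prim w))) w := by
  have h := (hasFDerivAt_id (𝕜 := ℝ) w).add (P.inclTilde.hasFDerivAt.comp w
    ((hasFDerivAt_nemytskii hf (P.prim w)).comp w P.prim.hasFDerivAt))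
  convert! h using 1
  rw [perturbation, sub_neg_eq_add]
  rfl

/-- The a priori bound: `prim` is bounded on preimages of bounded sets under the adapted map. -/
theorem exists_norm_prim_le (ht : IsTame f) (C : ℝ) :
    ∃ R, ∀ w, ‖P.adapted hf w‖ ≤ C → ‖P.prim w‖ ≤ R := by
  obtain ⟨Λ, hΛ0, hΛ⟩ := exists_abs_le_of_continuous hf.continuous (‖P.prim‖ * C)
  obtain ⟨R, hR⟩ := ht.exists_norm_le hf
    (max (‖P.prim‖ * (C + 1)) (Λ + 1 + 2 * (C + 1)))
  refine ⟨R, fun w hw => ?_⟩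
  set z := P.adapted hf w
  set u := P.prim w
  set N := nemytskii f hf u
  set l := ∫ t, N t
  -- The splitting `u = q + prim z` isolates a part that is always `C¹`, even when `z` is only in
  -- `L²`, and a part bounded by `‖prim‖ * C`.
  set q := -P.prim (P.inclTilde N)
  have hqu : u = q + P.prim z := by
    simp only [q, z, adapted, map_add]
    abel
  have hq' (x : ℝ) : HasDerivAt (fun y : ℝ => q (y : UnitAddCircle))
      (l - N (x : UnitAddCircle)) x := by
    simpa using! (P.hasDerivAt_prim_inclTilde N x).neg
  have hq0 : ∫ t, q t = 0 := by
    simp only [q, ← map_neg P.prim]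
    rw [P.integral_prim, map_neg, avg_inclTilde, neg_zero]
  obtain ⟨x₀, hx₀⟩ := q.exists_eq_integral
  rw [hq0] at hx₀
  have hNle (x : ℝ) (hx : q (x : UnitAddCircle) = 0) : |N (x : UnitAddCircle)| ≤ Λ := by
    refine hΛ _ _ ?_
    rw [hqu, ContinuousMap.add_apply, hx, zero_add]
    exact ((P.prim z).norm_coe_le_norm _).trans
      ((P.prim.le_opNorm z).trans (by gcongr))
  -- Where `q = 0`, `u` equals `prim z`, so `N` is bounded by `Λ` there. Zeros of `q` with `q' = l -
  -- N` of either sign bound `l` from both sides.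
  have hl : |l| ≤ Λ := by
    have hp := UnitAddCircle.periodic_coe q
    obtain ⟨x, hx, hx'⟩ := hp.exists_eq_deriv_nonpos hq' x₀
    obtain ⟨y, hy, hy'⟩ := hp.exists_eq_deriv_nonneg hq' x₀
    have h1 := abs_le.1 (hNle x (hx.trans hx₀))
    have h2 := abs_le.1 (hNle y (hy.trans hx₀))
    exact abs_le.2 ⟨by linarith, by linarith⟩
  -- The barrier needs a differentiable function, so `z` is replaced by a nearby continuous `g`, and
  -- `u` by `v = q + prim g`. Then `v' = e - f(t, v)`, where `e` is `g`, plus the constant `l - m`,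
  -- plus an error of size at most `1`.
  refine le_of_forall_pos_le_add fun ε hε => ?_
  obtain ⟨δ, hδ, Hδ⟩ := Metric.continuousAt_iff.1
    ((continuous_nemytskii hf).continuousAt (x := u)) 1 one_pos
  obtain ⟨z', ⟨hz1, hz2⟩, g, rfl⟩ := P.denseRange_incl.inter_open_nonempty
    (Metric.ball z 1 ∩ P.prim ⁻¹' Metric.ball (P.prim z) (min δ ε))
    (Metric.isOpen_ball.inter (Metric.isOpen_ball.preimage P.prim.continuous))
    ⟨z, Metric.mem_ball_self one_pos, Metric.mem_ball_self (lt_min hδ hε)⟩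
  have hgn : ‖P.incl g‖ ≤ C + 1 := by
    have := norm_le_norm_add_norm_sub z (P.incl g)
    rw [← dist_eq_norm] at this
    linarith [Metric.mem_ball'.1 hz1]
  have hgi : ∫ t, |g t| ≤ C + 1 := (P.integral_abs_le g).trans hgn
  set v := q + P.prim (P.incl g)
  have hvu : dist v u < min δ ε := by
    rw [hqu, dist_add_left]
    exact hz2
  have hNv : ‖nemytskii f hf v - N‖ ≤ 1 := by
    rw [← dist_eq_norm]
    exact (Hδ (hvu.trans_le (min_le_left _ _))).le
  set m := ∫ t, g t
  have hm : |m| ≤ C + 1 := abs_integral_le_integral_abs.trans hgi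
  let e : C0 := ContinuousMap.const _ (l - m) + (nemytskii f hf v - N) + g
  have he (t) : e t = l - m + (nemytskii f hf v - N) t + g t := rfl
  have hv := hR v e (fun x => ?_) ⟨x₀, ?_⟩ ?_
  · calc ‖u‖ ≤ ‖v‖ + ‖v - u‖ := norm_le_norm_add_norm_sub' u v |>.trans (by rw [norm_sub_rev])
      _ ≤ R + ε := by
        rw [← dist_eq_norm]
        exact add_le_add hv (hvu.le.trans (min_le_right _ _))
  · convert! (hq' x).add (P.hasDerivAt_prim_incl g x) using 1
    rw [he]
    change l - m + (f x (v x) - N x) + g x - f x (v x) = _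
    ring
  · refine le_trans ?_ (le_max_left _ _)
    change |q _ + _| ≤ _
    rw [hx₀, zero_add]
    exact (ContinuousMap.norm_coe_le_norm _ _).trans
      ((P.prim.le_opNorm _).trans (by gcongr))
  · refine le_trans ?_ (le_max_right _ _)
    calc ∫ t, |e t| ≤ ∫ t, ((Λ + (C + 1) + 1) + |g t|) := by
          refine integral_mono (C0.integrable e).abs
            ((integrable_const _).add (C0.integrable g).abs) fun t => ?_
          simp only [he]
          have h1 := (ContinuousMap.norm_coe_le_norm (nemytskii f hf v - N) t).trans hNv
          rw [Real.norm_eq_abs] at h1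
          refine (abs_add_three _ _ _).trans ?_
          have h2 := abs_sub l m
          linarith
      _ = Λ + (C + 1) + 1 + ∫ t, |g t| := by
          rw [integral_add (integrable_const _) (C0.integrable g).abs]
          simp
      _ ≤ Λ + 1 + 2 * (C + 1) := by linarith

/-- If the images `s n` converge, the a priori bound controls `prim (w n)`, and `w n = s n -
inclTilde (f(t, prim (w n)))` is then bounded. By compactness `prim (w n)` converges along a
subsequence, and the same formula makes `w n` converge. -/
theorem isClosed_range_adapted (ht : IsTame f) : IsClosed (range (P.adapted hf)) := by
  refine isClosed_of_closure_subset fun z hz => ?_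
  obtain ⟨s, hs, hsz⟩ := mem_closure_iff_seq_limit.1 hz
  choose w hw using hs
  obtain ⟨C, hC⟩ := hsz.norm.bddAbove_range
  obtain ⟨R, hR⟩ := P.exists_norm_prim_le hf ht C
  have hb (n) : ‖P.prim (w n)‖ ≤ R := hR _ (by rw [hw]; exact hC ⟨n, rfl⟩)
  obtain ⟨D, hD0, hD⟩ := exists_abs_le_of_continuous hf.continuous R
  have hwb (n) : w n ∈ Metric.closedBall (0 : B) (C + ‖P.inclTilde‖ * D) := by
    have h1 : ‖P.inclTilde (nemytskii f hf (P.prim (w n)))‖ ≤ ‖P.inclTilde‖ * D :=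
      P.inclTilde.le_opNorm_of_le ((ContinuousMap.norm_le _ hD0).2 fun t =>
        hD _ _ (((P.prim (w n)).norm_coe_le_norm t).trans (hb n)))
    have h2 : w n = s n - P.inclTilde (nemytskii f hf (P.prim (w n))) := by
      rw [← hw, adapted, add_sub_cancel_right]
    rw [mem_closedBall_zero_iff, h2]
    exact (norm_sub_le _ _).trans (add_le_add (hC ⟨n, rfl⟩) h1)
  obtain ⟨K, hK, hKsub⟩ := P.isCompactOperator_prim.image_closedBall_subset_compact
    (C + ‖P.inclTilde‖ * D)
  obtain ⟨u, -, φ, hφ, hu⟩ := hK.tendsto_subseq fun n => hKsub ⟨w n, hwb n, rfl⟩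
  have hlim : Filter.Tendsto (w ∘ φ) Filter.atTop
      (nhds (z - P.inclTilde (nemytskii f hf u))) := by
    have h3 := (hsz.comp hφ.tendsto_atTop).sub
      (((P.inclTilde.continuous.comp (continuous_nemytskii hf)).tendsto u).comp hu)
    refine h3.congr fun n => ?_
    change s (φ n) - P.inclTilde (nemytskii f hf (P.prim (w (φ n)))) = w (φ n)
    rw [← hw, adapted, add_sub_cancel_right]
  refine ⟨_, tendsto_nhds_unique (((P.contDiff_adapted hf).continuous.tendsto _).comp hlim) ?_⟩
  refine (hsz.comp hφ.tendsto_atTop).congr fun n => ?_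
  simp only [Function.comp_apply, hw]

/-- For a tame nonlinearity the adapted map is a diffeomorphism. -/
theorem exists_diffeomorph_adapted [CompleteSpace B] (ht : IsTame f) :
    ∃ Θ : Diffeomorph 𝓘(ℝ, B) 𝓘(ℝ, B) B B ∞, ∀ w, Θ w = P.adapted hf w := by
  have hsm := P.contDiff_adapted hf
  have hderiv (w : B) : ∃ A : B ≃L[ℝ] B, HasFDerivAt (P.adapted hf) (A : B →L[ℝ] B) w := by
    obtain ⟨U, hU⟩ := P.isUnit_one_sub_perturbation
      (nemytskii (stateDeriv f) hf.stateDeriv (P.prim w))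
    refine ⟨ContinuousLinearEquiv.ofUnit U, ?_⟩
    have h := P.hasFDerivAt_adapted hf w
    rw [← hU] at h
    exact h
  choose A hA using hderiv
  -- Inverse function theorem at each point; the open and closed range is then everything, by
  -- connectedness.
  have hopen : IsOpenMap (P.adapted hf) := isOpenMap_iff_nhds_le.2 fun w =>
    ((hsm.contDiffAt.hasStrictFDerivAt' (hA w) (by simp)).map_nhds_eq_of_equiv).ge
  have hsurj : Function.Surjective (P.adapted hf) := by
    rw [← range_eq_univ]
    exact IsClopen.eq_univ ⟨P.isClosed_range_adapted hf ht, hopen.isOpen_range⟩ (range_nonempty _)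
  let e := (Equiv.ofBijective _ ⟨P.adapted_injective hf, hsurj⟩).toHomeomorphOfContinuousOpen
    hsm.continuous hopen
  exact ⟨⟨e.toEquiv, hsm.contMDiff, (e.contDiff_symm hA hsm).contMDiff⟩, fun w => rfl⟩

/-- Global adapted coordinates for `F u = u' + f(t, u)`, when `u ↦ u' + ∫ u` is an isomorphism with
values in `B`. -/
theorem hasGlobalAdaptedCoordinates [CompleteSpace B] (ht : IsTame f) {B₁ : Type*}
    [NormedAddCommGroup B₁] [NormedSpace ℝ B₁] {S₁ : MeanSplitting B₁} {F : B₁ → B}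
    (J : B₁ ≃L[ℝ] B) (hJ : ∀ u, S.avg (J u) = S₁.avg u)
    (hF : ∀ u, F u = S.tilde (J u) + P.incl (nemytskii f hf (P.prim (J u)))) :
    HasGlobalAdaptedCoordinates S₁ S F := by
  obtain ⟨Θ, hΘ⟩ := P.exists_diffeomorph_adapted hf ht
  have hF' : ContDiff ℝ ∞ F := by
    have h := ((S.tildeL P.continuous_avg).contDiff.comp J.contDiff).add
      (P.incl.contDiff.comp ((contDiff_nemytskii hf).comp (P.prim.contDiff.comp J.contDiff)))
    convert! h using 1
    ext1 u
    simp [hF]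
  have h₁ : Continuous S₁.avg := by
    have := P.continuous_avg.comp J.continuous
    convert! this using 1
    exact funext fun u => (hJ u).symm
  refine hasGlobalAdaptedCoordinates_of_diffeomorph h₁ P.continuous_avg hF'
    (J.toDiffeomorph.trans Θ) fun u => ?_
  change Θ (J u) = _
  rw [hΘ, adapted, adaptedMap, hF, ← hJ, inclTilde_apply]
  have e : ∀ v w : B, S.tilde (v + w) = S.tilde v + S.tilde w := fun v w => by
    simpa using map_add (S.tildeL P.continuous_avg) v w
  rw [e, S.tilde_of_mem (S.tilde_mem _), add_right_comm, S.tilde_add_avg]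

end PrimitiveOperator

/-! ### Primitives of integrable functions on the circle -/

section Circle

theorem ae_coe_of_ae {P : UnitAddCircle → Prop} (h : ∀ᵐ t, P t) :
    ∀ᵐ x : ℝ, P (x : UnitAddCircle) := by
  rw [← Measure.restrict_univ (μ := (volume : Measure ℝ)), ← iUnion_Ioc_intCast ℝ,
    ae_restrict_iUnion_iff]
  exact fun n => (UnitAddCircle.measurePreserving_mk n).quasiMeasurePreserving.ae h

theorem intervalIntegrable_coe {v : UnitAddCircle → ℝ} (hv : Integrable v) (a b : ℝ) :
    IntervalIntegrable (fun x : ℝ => v (x : UnitAddCircle)) volume a b := by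
  refine (UnitAddCircle.periodic_coe v).intervalIntegrable one_ne_zero (t := 0) ?_ a b
  rw [intervalIntegrable_iff_integrableOn_Ioc_of_le (by norm_num)]
  exact ((UnitAddCircle.measurePreserving_mk 0).integrable_comp hv.aestronglyMeasurable).2 hv

/-- The primitive vanishing at `0` of the average-zero part of an integrable function. -/
def circlePrimitive (v : UnitAddCircle → ℝ) (hv : Integrable v) : C0 where
  toFun := Function.Periodic.lift (f := fun x : ℝ => (∫ r in (0 : ℝ)..x, v r) - x * ∫ t, v t)
    (c := (1 : ℝ)) fun x => by
      change (∫ r in (0 : ℝ)..x + 1, v r) - (x + 1) * _ = _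
      rw [← intervalIntegral.integral_add_adjacent_intervals (intervalIntegrable_coe hv 0 x)
        (intervalIntegrable_coe hv x (x + 1)), UnitAddCircle.intervalIntegral_preimage x v]
      ring
  continuous_toFun := by
    refine QuotientAddGroup.isOpenQuotientMap_mk.isQuotientMap.continuous_iff.2 ?_
    exact (intervalIntegral.continuous_primitive (intervalIntegrable_coe hv) 0).sub
      (continuous_id.mul continuous_const)

theorem circlePrimitive_coe {v : UnitAddCircle → ℝ} (hv : Integrable v) (x : ℝ) :
    circlePrimitive v hv (x : UnitAddCircle) =
      (∫ r in (0 : ℝ)..x, v (r : UnitAddCircle)) - x * ∫ t, v t := rfl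

theorem circlePrimitive_congr {v w : UnitAddCircle → ℝ} (hv : Integrable v) (hw : Integrable w)
    (h : v =ᵐ[volume] w) : circlePrimitive v hv = circlePrimitive w hw := by
  ext t
  obtain ⟨x, rfl⟩ := QuotientAddGroup.mk_surjective t
  change circlePrimitive v hv (x : UnitAddCircle) = circlePrimitive w hw (x : UnitAddCircle)
  rw [circlePrimitive_coe, circlePrimitive_coe, integral_congr_ae h]
  congr 1
  refine intervalIntegral.integral_congr_ae ?_
  filter_upwards [ae_coe_of_ae h] with r hr _ using hr

theorem circlePrimitive_add {v w : UnitAddCircle → ℝ} (hv : Integrable v) (hw : Integrable w) :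
    circlePrimitive (v + w) (hv.add hw) = circlePrimitive v hv + circlePrimitive w hw := by
  ext t
  obtain ⟨x, rfl⟩ := QuotientAddGroup.mk_surjective t
  change circlePrimitive _ _ (x : UnitAddCircle) =
    circlePrimitive v hv (x : UnitAddCircle) + circlePrimitive w hw (x : UnitAddCircle)
  simp only [circlePrimitive_coe, Pi.add_apply]
  rw [integral_add hv hw, intervalIntegral.integral_add (intervalIntegrable_coe hv 0 x)
    (intervalIntegrable_coe hw 0 x)]
  ring

theorem circlePrimitive_smul {v : UnitAddCircle → ℝ} (hv : Integrable v) (c : ℝ) :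
    circlePrimitive (c • v) (hv.smul c) = c • circlePrimitive v hv := by
  ext t
  obtain ⟨x, rfl⟩ := QuotientAddGroup.mk_surjective t
  change circlePrimitive _ _ (x : UnitAddCircle) = c * circlePrimitive v hv (x : UnitAddCircle)
  simp only [circlePrimitive_coe, Pi.smul_apply, smul_eq_mul]
  rw [integral_const_mul, intervalIntegral.integral_const_mul]
  ring

theorem hasDerivAt_circlePrimitive (g : C0) (x : ℝ) :
    HasDerivAt (fun y : ℝ => circlePrimitive g g.integrable (y : UnitAddCircle))
      (g (x : UnitAddCircle) - ∫ t, g t) x := by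
  have hc : Continuous fun y : ℝ => g (y : UnitAddCircle) :=
    g.continuous.comp (AddCircle.continuous_mk' 1)
  simpa using! (intervalIntegral.integral_hasDerivAt_right (hc.intervalIntegrable 0 x)
    (hc.stronglyMeasurableAtFilter _ _) hc.continuousAt).sub
    ((hasDerivAt_id x).mul_const (∫ t, g t))

theorem norm_circlePrimitive_le {v : UnitAddCircle → ℝ} (hv : Integrable v) :
    ‖circlePrimitive v hv‖ ≤ 2 * ∫ t, |v t| := by
  have h0 : 0 ≤ ∫ t, |v t| := integral_nonneg fun t => abs_nonneg _
  refine (ContinuousMap.norm_le _ (by positivity)).2 fun t => ?_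
  obtain ⟨y, rfl⟩ := QuotientAddGroup.mk_surjective t
  obtain ⟨x, hx, hxy⟩ := (UnitAddCircle.periodic_coe
    (circlePrimitive v hv)).exists_mem_Ico one_pos y 0
  change ‖circlePrimitive v hv (y : UnitAddCircle)‖ ≤ _
  rw [hxy, circlePrimitive_coe, Real.norm_eq_abs]
  rw [zero_add] at hx
  have h1 : |∫ r in (0 : ℝ)..x, v (r : UnitAddCircle)| ≤ ∫ t, |v t| := by
    rw [← UnitAddCircle.intervalIntegral_preimage 0 (fun t => |v t|)]
    refine (intervalIntegral.abs_integral_le_integral_abs hx.1).trans ?_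
    exact intervalIntegral.integral_mono_interval le_rfl hx.1 (by linarith [hx.2])
      (Filter.Eventually.of_forall fun r => abs_nonneg _) (intervalIntegrable_coe hv.abs _ _)
  have h2 : |x * ∫ t, v t| ≤ ∫ t, |v t| := by
    rw [abs_mul, abs_of_nonneg hx.1]
    exact (mul_le_of_le_one_left (abs_nonneg _) hx.2.le).trans abs_integral_le_integral_abs
  exact (abs_sub _ _).trans (by linarith)

/-- The oscillation of the primitive of a square integrable function. -/
theorem abs_circlePrimitive_sub_le {v : UnitAddCircle → ℝ} (hv : MemLp v 2 volume) {η : ℝ}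
    (hη : 0 < η) {x y : ℝ} (hxy : |x - y| ≤ 1) :
    |circlePrimitive v (hv.integrable one_le_two) (x : UnitAddCircle) -
      circlePrimitive v (hv.integrable one_le_two) (y : UnitAddCircle)| ≤
      (η + ∫ t, |v t|) * |x - y| + η⁻¹ * ∫ t, v t ^ 2 := by
  wlog hle : y ≤ x generalizing x y
  · rw [abs_sub_comm, abs_sub_comm x y]
    exact this (by rwa [abs_sub_comm]) (le_of_not_ge hle)
  rw [abs_of_nonneg (sub_nonneg.2 hle)] at hxy ⊢
  have hi := hv.integrable one_le_two
  have hi2 := hv.integrable_sq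
  rw [circlePrimitive_coe, circlePrimitive_coe, sub_sub_sub_comm,
    intervalIntegral.integral_interval_sub_left (intervalIntegrable_coe hi _ _)
      (intervalIntegrable_coe hi _ _), ← sub_mul]
  refine (abs_sub _ _).trans ?_
  -- In place of Cauchy–Schwarz, the pointwise bound `|v| ≤ η + η⁻¹ v²`, proved by completing the
  -- square, is integrated.
  have h1 : |∫ r in y..x, v (r : UnitAddCircle)| ≤ η * (x - y) + η⁻¹ * ∫ t, v t ^ 2 := by
    refine (intervalIntegral.abs_integral_le_integral_abs hle).trans ?_
    calc ∫ r in y..x, |v (r : UnitAddCircle)|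
        ≤ ∫ r in y..x, (η + η⁻¹ * v (r : UnitAddCircle) ^ 2) := by
          refine intervalIntegral.integral_mono_on hle (intervalIntegrable_coe hi.abs _ _)
            (intervalIntegrable_const.add ((intervalIntegrable_coe hi2 _ _).const_mul _))
            fun r _ => ?_
          rw [← sq_abs, ← sub_nonneg]
          have : η + η⁻¹ * |v r| ^ 2 - |v r| =
              η⁻¹ * ((|v r| - η / 2) ^ 2 + 3 / 4 * η ^ 2) := by
            field_simp
            ring
          rw [this]
          positivity
      _ = η * (x - y) + η⁻¹ * ∫ r in y..x, v (r : UnitAddCircle) ^ 2 := by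
          rw [intervalIntegral.integral_add intervalIntegrable_const
            ((intervalIntegrable_coe hi2 _ _).const_mul _), intervalIntegral.integral_const,
            intervalIntegral.integral_const_mul, smul_eq_mul, mul_comm η]
      _ ≤ η * (x - y) + η⁻¹ * ∫ t, v t ^ 2 := by
          gcongr
          rw [← UnitAddCircle.intervalIntegral_preimage y (fun t => v t ^ 2)]
          exact intervalIntegral.integral_mono_interval le_rfl hle (by linarith)
            (Filter.Eventually.of_forall fun r => sq_nonneg _) (intervalIntegrable_coe hi2 _ _)
  have h2 : |(x - y) * ∫ t, v t| ≤ (∫ t, |v t|) * (x - y) := by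
    rw [abs_mul, abs_of_nonneg (sub_nonneg.2 hle), mul_comm]
    exact mul_le_mul_of_nonneg_right abs_integral_le_integral_abs (sub_nonneg.2 hle)
  linarith

theorem absolutelyContinuousOnInterval_circlePrimitive {v : UnitAddCircle → ℝ}
    (hv : Integrable v) : AbsolutelyContinuousOnInterval
      (fun x : ℝ => circlePrimitive v hv (x : UnitAddCircle)) 0 1 := by
  have h := (intervalIntegrable_coe hv 0 1).absolutelyContinuousOnInterval_intervalIntegral
    (c := 0) (by simp)
  have h' : AbsolutelyContinuousOnInterval (fun x : ℝ => x * ∫ t, v t) 0 1 :=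
    (contDiff_id.mul contDiff_const).contDiffOn.absolutelyContinuousOnInterval
  exact h.sub h'

theorem ae_hasDerivAt_circlePrimitive {v : UnitAddCircle → ℝ} (hv : Integrable v) :
    ∀ᵐ x : ℝ, x ∈ uIcc (0 : ℝ) 1 →
      HasDerivAt (fun y : ℝ => circlePrimitive v hv (y : UnitAddCircle))
        (v (x : UnitAddCircle) - ∫ t, v t) x := by
  filter_upwards [(intervalIntegrable_coe hv 0 1).ae_hasDerivAt_integral] with x hx hx'
  simpa using! (hx hx' 0 (by simp)).sub ((hasDerivAt_id x).mul_const (∫ t, v t))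

end Circle

/-! ### The compact primitive operator on `L²` and on `C⁰` -/

section PrimitiveL2

theorem L2.integrable (w : L2) : Integrable w := (Lp.memLp w).integrable one_le_two

theorem L2.integral_abs_le (w : L2) : ∫ t, |w t| ≤ ‖w‖ := by
  have h := integral_norm_eq_lintegral_enorm (Lp.aestronglyMeasurable w)
  rw [← eLpNorm_one_eq_lintegral_enorm] at h
  simp only [Real.norm_eq_abs] at h
  rw [h, Lp.norm_def]
  exact ENNReal.toReal_mono (Lp.eLpNorm_ne_top w)
    (eLpNorm_le_eLpNorm_of_exponent_le one_le_two (Lp.aestronglyMeasurable w))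

theorem L2.integral_sq (w : L2) : ∫ t, w t ^ 2 = ‖w‖ ^ 2 := by
  rw [← real_inner_self_eq_norm_sq, MeasureTheory.L2.inner_def]
  simp [pow_two]

theorem meanL2_avg (w : L2) : meanL2.avg w = ∫ t, w t := rfl

theorem continuous_meanL2_avg : Continuous meanL2.avg := by
  refine AddMonoidHomClass.continuous_of_bound meanL2.avg 1 fun w => ?_
  rw [one_mul, meanL2_avg]
  exact abs_integral_le_integral_abs.trans (L2.integral_abs_le w)

/-- The linear map taking `w` to the function `u` with `u' = w - ∫ w` and `∫ u = ∫ w`. -/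
def primitiveLin : L2 →ₗ[ℝ] C0 where
  toFun w := circlePrimitive w (L2.integrable w) +
    ContinuousMap.const _ ((∫ t, w t) - ∫ t, circlePrimitive w (L2.integrable w) t)
  map_add' v w := by
    have h : circlePrimitive (v + w : L2) (L2.integrable _) =
        circlePrimitive v (L2.integrable v) + circlePrimitive w (L2.integrable w) := by
      rw [← circlePrimitive_add]
      exact circlePrimitive_congr _ _ (Lp.coeFn_add v w)
    have ha : ∫ t, (v + w : L2) t = (∫ t, v t) + ∫ t, w t := map_add meanL2.avg v w
    have hb := map_add meanC0.avg (circlePrimitive v (L2.integrable v))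
      (circlePrimitive w (L2.integrable w))
    rw [h, ha]
    ext t
    change _ + ((∫ t, v t) + (∫ t, w t) - meanC0.avg _) = _ + (_ - meanC0.avg _) +
      (_ + (_ - meanC0.avg _))
    rw [hb, ContinuousMap.add_apply]
    ring
  map_smul' c v := by
    have h : circlePrimitive (c • v : L2) (L2.integrable _) =
        c • circlePrimitive v (L2.integrable v) := by
      rw [← circlePrimitive_smul]
      exact circlePrimitive_congr _ _ (Lp.coeFn_smul c v)
    have ha : ∫ t, (c • v : L2) t = c * ∫ t, v t := map_smul meanL2.avg c v
    have hb := map_smul meanC0.avg c (circlePrimitive v (L2.integrable v))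
    rw [h, ha]
    ext t
    change _ + (c * (∫ t, v t) - meanC0.avg _) = c * (_ + (_ - meanC0.avg _))
    rw [hb, ContinuousMap.smul_apply, smul_eq_mul, smul_eq_mul]
    ring

theorem C0.abs_integral_le (u : C0) : |∫ t, u t| ≤ ‖u‖ := by
  have := norm_integral_le_of_norm_le_const (μ := (volume : Measure UnitAddCircle))
    (Filter.Eventually.of_forall u.norm_coe_le_norm)
  simpa using this

/-- The operator `primitiveLin`, as a continuous linear map. -/
def primitiveL2 : L2 →L[ℝ] C0 := primitiveLin.mkContinuous 5 fun w => by
  -- The constant is `5 = 2 + 1 + 2`: the primitive, the average of `w`, and the average of the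
  -- primitive.
  have h1 := norm_circlePrimitive_le (L2.integrable w)
  have h2 := L2.integral_abs_le w
  have h3 := C0.abs_integral_le (circlePrimitive w (L2.integrable w))
  have h4 : |∫ t, w t| ≤ ∫ t, |w t| := abs_integral_le_integral_abs
  refine (norm_add_le _ _).trans ?_
  have h5 : ‖ContinuousMap.const UnitAddCircle
      ((∫ t, w t) - ∫ t, circlePrimitive w (L2.integrable w) t)‖ ≤
      |(∫ t, w t) - ∫ t, circlePrimitive w (L2.integrable w) t| :=
    (ContinuousMap.norm_le _ (abs_nonneg _)).2 fun t => le_rfl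
  have h6 := abs_sub (∫ t, w t) (∫ t, circlePrimitive w (L2.integrable w) t)
  linarith

theorem primitiveL2_apply (w : L2) : primitiveL2 w = circlePrimitive w (L2.integrable w) +
    ContinuousMap.const _ ((∫ t, w t) - ∫ t, circlePrimitive w (L2.integrable w) t) := rfl

theorem integral_primitiveL2 (w : L2) : ∫ t, primitiveL2 w t = ∫ t, w t := by
  rw [primitiveL2_apply]
  simp only [ContinuousMap.add_apply, ContinuousMap.const_apply]
  rw [integral_add (C0.integrable _) (integrable_const _)]
  simp

/-- Arzelà–Ascoli: an `L²` bound on the derivative makes the primitives of the unit ball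
equicontinuous. -/
theorem isCompactOperator_primitiveL2 : IsCompactOperator primitiveL2 := by
  refine (isCompactOperator_iff_image_closedBall_subset_compact
    (primitiveL2 : L2 →ₗ[ℝ] C0) one_pos).2 ?_
  let e := ContinuousMap.isometryEquivBoundedOfCompact UnitAddCircle ℝ
  let A := e '' (primitiveL2 '' Metric.closedBall 0 1)
  have hA : IsCompact (closure A) := by
    refine BoundedContinuousFunction.arzela_ascoli (Icc (-‖primitiveL2‖) ‖primitiveL2‖)
      isCompact_Icc A ?_ fun t => ?_
    · rintro _ t ⟨_, ⟨w, hw, rfl⟩, rfl⟩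
      rw [mem_closedBall_zero_iff] at hw
      exact abs_le.1 (((primitiveL2 w).norm_coe_le_norm t).trans
        ((primitiveL2.le_opNorm w).trans (mul_le_of_le_one_right (norm_nonneg _) hw)))
    · rw [Metric.equicontinuousAt_iff_right]
      intro ε hε
      obtain ⟨x, rfl⟩ := QuotientAddGroup.mk_surjective t
      rw [← QuotientAddGroup.isOpenQuotientMap_mk.map_nhds_eq, Filter.eventually_map]
      have hc : Filter.Tendsto (fun y : ℝ => (2 / ε + 1) * |x - y| + ε / 2) (nhds x)
          (nhds ((2 / ε + 1) * |x - x| + ε / 2)) := by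
        refine Continuous.tendsto ?_ x
        fun_prop
      rw [sub_self, abs_zero, mul_zero, zero_add] at hc
      have h1 : ∀ᶠ y in nhds x, |x - y| ≤ 1 := by
        filter_upwards [Metric.closedBall_mem_nhds x one_pos] with y hy
        rwa [Metric.mem_closedBall', Real.dist_eq] at hy
      filter_upwards [hc.eventually_lt_const (half_lt_self hε), h1] with y hy hy1
      rintro ⟨_, _, ⟨w, hw, rfl⟩, rfl⟩
      rw [mem_closedBall_zero_iff] at hw
      -- With `η = 2 / ε` the term `η⁻¹ ‖w‖²` is at most `ε / 2` on the unit ball, and the remaining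
      -- term tends to `0` with `|x - y|`.
      have h2 := abs_circlePrimitive_sub_le (Lp.memLp w) (η := 2 / ε) (by positivity) hy1
      rw [L2.integral_sq] at h2
      have h3 := (L2.integral_abs_le w).trans hw
      have h4 : ‖w‖ ^ 2 ≤ 1 := pow_le_one₀ (norm_nonneg _) hw
      change |primitiveL2 w x - primitiveL2 w y| < ε
      rw [primitiveL2_apply]
      simp only [ContinuousMap.add_apply, ContinuousMap.const_apply, add_sub_add_right_eq_sub]
      calc _ ≤ _ := h2
        _ ≤ (2 / ε + 1) * |x - y| + (2 / ε)⁻¹ * 1 := by gcongr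
        _ = (2 / ε + 1) * |x - y| + ε / 2 := by rw [inv_div, mul_one]
        _ < ε := hy
  refine ⟨e.symm '' closure A, hA.image e.symm.continuous, ?_⟩
  rintro _ ⟨w, hw, rfl⟩
  exact ⟨e (primitiveL2 w), subset_closure ⟨_, ⟨w, hw, rfl⟩, rfl⟩, e.symm_apply_apply _⟩

/-- The inclusion of the continuous functions in `L²`. -/
def inclL2 : C0 →L[ℝ] L2 := ContinuousMap.toLp 2 volume ℝ

theorem coeFn_inclL2 (g : C0) : inclL2 g =ᵐ[volume] g := ContinuousMap.coeFn_toLp _ _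

theorem integral_inclL2 (g : C0) : ∫ t, inclL2 g t = ∫ t, g t := integral_congr_ae (coeFn_inclL2 g)

theorem hasDerivAt_primitiveL2_inclL2 (g : C0) (x : ℝ) :
    HasDerivAt (fun y : ℝ => primitiveL2 (inclL2 g) (y : UnitAddCircle))
      (g (x : UnitAddCircle) - ∫ t, g t) x := by
  rw [primitiveL2_apply, circlePrimitive_congr _ g.integrable (coeFn_inclL2 g)]
  exact (hasDerivAt_circlePrimitive g x).add_const _

/-- The primitive operator on `L²`. -/
def primitiveOperatorL2 : PrimitiveOperator meanL2 where
  continuous_avg := continuous_meanL2_avg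
  incl := inclL2
  denseRange_incl := ContinuousMap.toLp_denseRange ℝ volume ℝ (by simp)
  incl_one := rfl
  avg_incl := integral_inclL2
  integral_abs_le g := by
    refine le_of_eq_of_le ?_ (L2.integral_abs_le (inclL2 g))
    refine integral_congr_ae ?_
    filter_upwards [coeFn_inclL2 g] with t ht
    rw [ht]
  prim := primitiveL2
  isCompactOperator_prim := isCompactOperator_primitiveL2
  integral_prim := integral_primitiveL2
  hasDerivAt_prim_incl := hasDerivAt_primitiveL2_inclL2

/-- The primitive operator on `C⁰`. -/
def primitiveOperatorC0 : PrimitiveOperator meanC0 where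
  continuous_avg := AddMonoidHomClass.continuous_of_bound meanC0.avg 1 fun u => by
    rw [one_mul]
    exact C0.abs_integral_le u
  incl := ContinuousLinearMap.id ℝ C0
  denseRange_incl := Function.surjective_id.denseRange
  incl_one := rfl
  avg_incl _ := rfl
  integral_abs_le g := by
    have := C0.abs_integral_le |g|
    refine (le_abs_self _).trans (this.trans ?_)
    exact (ContinuousMap.norm_le _ (norm_nonneg _)).2 fun t => by
      simpa using! g.norm_coe_le_norm t
  prim := primitiveL2 ∘L inclL2
  isCompactOperator_prim := isCompactOperator_primitiveL2.comp_clm inclL2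
  integral_prim w := (integral_primitiveL2 _).trans (integral_inclL2 w)
  hasDerivAt_prim_incl := hasDerivAt_primitiveL2_inclL2

end PrimitiveL2

/-! ### The isomorphism `u ↦ u' + ∫ u` from `C¹` to `C⁰` -/

section IsomorphismC

theorem C1.integral_deriv (u : C1) : ∫ t, u.1.2 t = 0 := by
  have hc : Continuous fun x : ℝ => u.1.2 (x : UnitAddCircle) :=
    u.1.2.continuous.comp (AddCircle.continuous_mk' 1)
  rw [← UnitAddCircle.intervalIntegral_preimage 0, intervalIntegral.integral_eq_sub_of_hasDerivAt
    (fun x _ => u.2 x) (hc.intervalIntegrable _ _)]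
  exact sub_eq_zero.2 (UnitAddCircle.periodic_coe u.1.1 0)

theorem tilde_meanC0_coe (w : C0) (t : UnitAddCircle) :
    meanC0.tilde w t = w t - ∫ t, w t := by
  change w t - meanC0.avg w * 1 = _
  rw [mul_one]
  rfl

theorem continuous_meanC1_avg : Continuous meanC1.avg :=
  primitiveOperatorC0.continuous_avg.comp (continuous_fst.comp continuous_subtype_val)

/-- The element of `C¹` with average `∫ w` and derivative `w - ∫ w`. -/
def primitiveC1 (w : C0) : C1 :=
  ⟨(primitiveOperatorC0.prim w, meanC0.tilde w), fun x => by
    rw [tilde_meanC0_coe]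
    exact primitiveOperatorC0.hasDerivAt_prim_incl w x⟩

theorem avg_primitiveC1 (w : C0) : meanC1.avg (primitiveC1 w) = meanC0.avg w :=
  primitiveOperatorC0.integral_prim w

theorem tilde_deriv_add_avg (u : C1) :
    meanC0.tilde (u.1.2 + meanC1.avg u • meanC0.one) = u.1.2 := by
  rw [meanC0.tilde_add_smul_one, meanC0.tilde_of_mem]
  exact C1.integral_deriv u

theorem prim_deriv_add_avg (u : C1) :
    primitiveOperatorC0.prim (u.1.2 + meanC1.avg u • meanC0.one) = u.1.1 := by
  set w := u.1.2 + meanC1.avg u • meanC0.one with hw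
  -- Both functions have the same derivative and the same average, so uniqueness applies with zero
  -- right-hand side.
  refine sub_eq_zero.1 (C0.eq_zero_of_hasDerivAt (g := 0) (μ := 0) (L := 0) (fun x => ?_)
    (fun t => by simp) ?_)
  · have h := ((primitiveC1 w).2 x).sub (u.2 x)
    have e : (primitiveC1 w).1.2 = u.1.2 := tilde_deriv_add_avg u
    rw [e, sub_self] at h
    simpa using! h
  · have h := map_sub meanC1.avg (primitiveC1 w) u
    rw [avg_primitiveC1, hw, map_add, map_smul, meanC0.avg_one, smul_eq_mul, mul_one,
      show meanC0.avg u.1.2 = 0 from C1.integral_deriv u, zero_add, sub_self] at h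
    exact h

/-- The isomorphism `u ↦ u' + ∫ u` from `C¹` to `C⁰`. -/
def derivAddAvgC : C1 ≃L[ℝ] C0 where
  toFun u := u.1.2 + meanC1.avg u • meanC0.one
  invFun := primitiveC1
  map_add' u v := by
    rw [map_add, add_smul]
    exact add_add_add_comm _ _ _ _
  map_smul' c u := by
    rw [map_smul, smul_eq_mul, mul_smul]
    exact (smul_add c _ _).symm
  left_inv u := Subtype.ext (Prod.ext (prim_deriv_add_avg u) (tilde_deriv_add_avg u))
  right_inv w := by
    change meanC0.tilde w + meanC1.avg (primitiveC1 w) • meanC0.one = w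
    rw [avg_primitiveC1, meanC0.tilde_add_avg]
  continuous_toFun := (continuous_snd.comp continuous_subtype_val).add
    (continuous_meanC1_avg.smul continuous_const)
  continuous_invFun := by
    refine Continuous.subtype_mk (primitiveOperatorC0.prim.continuous.prodMk ?_) _
    convert! (meanC0.tildeL primitiveOperatorC0.continuous_avg).continuous using 1

theorem derivAddAvgC_apply (u : C1) :
    derivAddAvgC u = u.1.2 + meanC1.avg u • meanC0.one := rfl

end IsomorphismC

/-! ### The isomorphism `u ↦ u' + ∫ u` from `H¹` to `L²` -/

section IsomorphismH

theorem coeFn_tilde_meanL2 (w : L2) : meanL2.tilde w =ᵐ[volume] fun t => w t - ∫ t, w t := by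
  have h1 := Lp.coeFn_sub w (meanL2.avg w • meanL2.one)
  have h2 := Lp.coeFn_smul (meanL2.avg w) meanL2.one
  filter_upwards [h1, h2, coeFn_inclL2 1] with t h1 h2 h3
  have h3' : (meanL2.one : L2) t = 1 := h3
  rw [MeanSplitting.tilde, h1, Pi.sub_apply, h2, Pi.smul_apply, h3', smul_eq_mul, mul_one,
    meanL2_avg]

theorem isACRep_primitiveL2 (w : L2) :
    IsACRep (primitiveL2 w) (inclL2 (primitiveL2 w)) (meanL2.tilde w) := by
  have hconst (c : ℝ) : AbsolutelyContinuousOnInterval (fun _ : ℝ => c) 0 1 :=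
    (contDiff_const (c := c)).contDiffOn.absolutelyContinuousOnInterval
  refine ⟨coeFn_inclL2 _, ?_, ?_⟩
  · exact (absolutelyContinuousOnInterval_circlePrimitive (L2.integrable w)).add (hconst _)
  · rw [ae_restrict_iff' measurableSet_Ioc]
    filter_upwards [ae_hasDerivAt_circlePrimitive (L2.integrable w),
      ae_coe_of_ae (coeFn_tilde_meanL2 w)] with x h1 h2 hx
    rw [h2, primitiveL2_apply]
    exact (h1 (by rw [uIcc_of_le zero_le_one]; exact Ioc_subset_Icc_self hx)).add_const _

theorem ae_uIcc_of_ae_restrict_Ioc {p : ℝ → Prop}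
    (h : ∀ᵐ x ∂(volume.restrict (Ioc (0 : ℝ) 1)), p x) : ∀ᵐ x : ℝ, x ∈ uIcc (0 : ℝ) 1 → p x := by
  rw [restrict_Ioc_eq_restrict_Icc, ae_restrict_iff' measurableSet_Icc] at h
  rwa [uIcc_of_le zero_le_one]

/-- The fundamental theorem of calculus for absolutely continuous functions, over one period. -/
theorem IsACRep.integral_deriv {r : C0} {u g : L2} (h : IsACRep r u g) : ∫ t, g t = 0 := by
  have h1 := h.2.1.integral_deriv_eq_sub
  have h2 : r ((1 : ℝ) : UnitAddCircle) - r ((0 : ℝ) : UnitAddCircle) = 0 := by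
    have := UnitAddCircle.periodic_coe r 0
    simp only [zero_add] at this
    rw [this, sub_self]
  rw [h2] at h1
  rw [← UnitAddCircle.intervalIntegral_preimage 0 (fun t => g t), zero_add]
  refine (intervalIntegral.integral_congr_ae ?_).trans h1
  filter_upwards [ae_uIcc_of_ae_restrict_Ioc h.2.2] with x hx hx'
  exact (hx (uIoc_subset_uIcc hx')).deriv.symm

theorem IsACRep.integral_eq {r : C0} {u g : L2} (h : IsACRep r u g) : ∫ t, u t = ∫ t, r t :=
  integral_congr_ae h.1

theorem IsACRep.eq_inclL2 {r : C0} {u g : L2} (h : IsACRep r u g) : u = inclL2 r :=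
  Lp.ext (h.1.trans (coeFn_inclL2 r).symm)

theorem IsACRep.tilde_deriv_add_avg {r : C0} {u g : L2} (h : IsACRep r u g) (c : ℝ) :
    meanL2.tilde (g + c • meanL2.one) = g := by
  rw [meanL2.tilde_add_smul_one, meanL2.tilde_of_mem]
  exact h.integral_deriv

/-- An absolutely continuous function is recovered from its derivative and its average. -/
theorem IsACRep.primitiveL2_eq {r : C0} {u g : L2} (h : IsACRep r u g) :
    primitiveL2 (g + meanL2.avg u • meanL2.one) = r := by
  set w := g + meanL2.avg u • meanL2.one with hw
  have hp := isACRep_primitiveL2 w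
  have hd : ∀ᵐ x : ℝ, x ∈ uIcc (0 : ℝ) 1 →
      HasDerivAt (fun y : ℝ => primitiveL2 w (y : UnitAddCircle) - r (y : UnitAddCircle)) 0 x := by
    filter_upwards [ae_uIcc_of_ae_restrict_Ioc h.2.2, ae_uIcc_of_ae_restrict_Ioc hp.2.2]
      with x h1 h2 hx
    have h3 := (h2 hx).sub (h1 hx)
    rwa [hw, h.tilde_deriv_add_avg, sub_self] at h3
  obtain ⟨C, hC⟩ := (hp.2.1.sub h.2.1).const_of_ae_hasDerivAt_zero hd
  have hconst : ∀ t, primitiveL2 w t - r t = C := fun t => by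
    obtain ⟨y, rfl⟩ := QuotientAddGroup.mk_surjective t
    obtain ⟨x, hx, hxy⟩ := (UnitAddCircle.periodic_coe
      (primitiveL2 w - r)).exists_mem_Ico one_pos y 0
    refine Eq.trans hxy (hC x ?_)
    rw [zero_add] at hx
    rw [uIcc_of_le zero_le_one]
    exact ⟨hx.1, hx.2.le⟩
  have hC0 : C = 0 := by
    have h1 : ∫ t, (primitiveL2 w t - r t) = C := by
      simp only [hconst]
      simp
    rw [integral_sub (C0.integrable _) (C0.integrable _), integral_primitiveL2,
      ← meanL2_avg, hw, map_add, map_smul, meanL2.avg_one, meanL2_avg g, h.integral_deriv,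
      meanL2_avg u, h.integral_eq] at h1
    simpa using h1.symm
  ext t
  rw [← sub_eq_zero, hconst, hC0]

/-- The element of `H¹` with average `∫ w` and derivative `w - ∫ w`. -/
def primitiveH1 (w : L2) : H1 :=
  ⟨WithLp.toLp 2 (inclL2 (primitiveL2 w), meanL2.tilde w), primitiveL2 w, isACRep_primitiveL2 w⟩

theorem avg_primitiveH1 (w : L2) : meanH1.avg (primitiveH1 w) = meanL2.avg w :=
  (integral_inclL2 _).trans (integral_primitiveL2 w)

theorem continuous_H1_fst : Continuous fun u : H1 => u.1.fst :=
  (WithLp.fstL 2 ℝ L2 L2).continuous.comp continuous_subtype_val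

theorem continuous_H1_snd : Continuous fun u : H1 => u.1.snd :=
  (WithLp.sndL 2 ℝ L2 L2).continuous.comp continuous_subtype_val

theorem continuous_meanH1_avg : Continuous meanH1.avg :=
  continuous_meanL2_avg.comp continuous_H1_fst

/-- The isomorphism `u ↦ u' + ∫ u` from `H¹` to `L²`. -/
def derivAddAvgH : H1 ≃L[ℝ] L2 where
  toFun u := u.1.snd + meanH1.avg u • meanL2.one
  invFun := primitiveH1
  map_add' u v := by
    rw [map_add, add_smul]
    exact add_add_add_comm _ _ _ _
  map_smul' c u := by
    rw [map_smul, smul_eq_mul, mul_smul]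
    exact (smul_add c _ _).symm
  left_inv u := by
    have h := H1rep_spec u
    refine Subtype.ext ((WithLp.equiv 2 (L2 × L2)).injective (Prod.ext ?_ ?_))
    · exact (congrArg inclL2 h.primitiveL2_eq).trans h.eq_inclL2.symm
    · exact h.tilde_deriv_add_avg _
  right_inv w := by
    change meanL2.tilde w + meanH1.avg (primitiveH1 w) • meanL2.one = w
    rw [avg_primitiveH1, meanL2.tilde_add_avg]
  continuous_toFun := continuous_H1_snd.add (continuous_meanH1_avg.smul continuous_const)
  continuous_invFun := by
    refine Continuous.subtype_mk ((WithLp.prodContinuousLinearEquiv 2 ℝ L2 L2).symm.continuous.comp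
      ((inclL2.continuous.comp primitiveL2.continuous).prodMk ?_)) _
    convert! (meanL2.tildeL continuous_meanL2_avg).continuous using 1

theorem derivAddAvgH_apply (u : H1) :
    derivAddAvgH u = u.1.snd + meanH1.avg u • meanL2.one := rfl

end IsomorphismH

end

/-! ### Conclusion in both function-space settings -/

theorem theorem1p2 (f : UnitAddCircle → ℝ → ℝ) (hf : IsSmoothNonlinearity f) (ht : IsTame f) :
    HasGlobalAdaptedCoordinates meanC1 meanC0 (operatorC f hf) ∧
    HasGlobalAdaptedCoordinates meanH1 meanL2 (operatorH f hf) := by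
  constructor
  · refine primitiveOperatorC0.hasGlobalAdaptedCoordinates hf ht derivAddAvgC (fun u => ?_)
      fun u => ?_
    · rw [derivAddAvgC_apply, map_add, map_smul, meanC0.avg_one, smul_eq_mul, mul_one,
        show meanC0.avg u.1.2 = 0 from C1.integral_deriv u, zero_add]
    · rw [derivAddAvgC_apply, tilde_deriv_add_avg, prim_deriv_add_avg]
      rfl
  · refine primitiveOperatorL2.hasGlobalAdaptedCoordinates hf ht derivAddAvgH (fun u => ?_)
      fun u => ?_
    · rw [derivAddAvgH_apply, map_add, map_smul, meanL2.avg_one, smul_eq_mul, mul_one,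
        show meanL2.avg u.1.snd = 0 from (H1rep_spec u).integral_deriv, zero_add]
    · have h := H1rep_spec u
      have e : primitiveOperatorL2.prim (u.1.snd + meanH1.avg u • meanL2.one) = H1rep u :=
        h.primitiveL2_eq
      rw [derivAddAvgH_apply, h.tilde_deriv_add_avg, e]
      rfl
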